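/- All graphs are finite and may have parallel edges but no loops; a graph is simple if it has no parallel edges. For a set $S$ of vertices of $G$ let $\partial(S)$ be the set of edges with precisely one end in $S$. An $r$-regular graph $G$ is an $r$-graph if $|\partial(S)|\ge r$ for every $S\subseteq V(G)$ of odd cardinality. For $i\ge 1$, let $T_i^r$ be the tree whose vertex degrees all lie in $\{1,r\}$ and which has a vertex of degree $r$, called the root, at distance $i$ from every leaf other than the root itself (the root is a leaf only if $r=1$, where $T_1^1=K_2$). An automorphism of a graph is a permutation $\alpha$ of its vertices such that the number of edges between $\alpha(u)$ and $\alpha(v)$ equals the number of edges between $u$ and $v$ for all vertices $u,v$. A rotation $r$-graph is an $r$-graph $G$ that, for some $i$, has a spanning tree $T$ isomorphic to $T_i^r$ and an automorphism $\alpha$ of $G$ which is also an automorphism of $T$, fixes the root of $T$, and is such that for every other vertex $u$ the smallest positive integer $k$ with $\alpha^k(u)=u$ is $k=r$. Collections of perfect matchings may contain the same perfect matching several times. **Corollary.** Let $r\ge 1$ be an odd integer. The following statements are equivalent: 1. (generalized Fulkerson Conjecture) Every $r$-graph $G$ has a collection of $2r$ perfect matchings such that every edge of $G$ is in precisely two of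 them. 2. Every simple rotation $r$-graph $G$ has a collection of $2r$ perfect matchings such that every edge of $G$ is in precisely two of them. 3. (generalized Berge Conjecture) Every $r$-graph $G$ has a collection of $2r-1$ perfect matchings such that every edge of $G$ is in at least one of them. 4. Every simple rotation $r$-graph $G$ has a collection of $2r-1$ perfect matchings such that every edge of $G$ is in at least one of them. -/

import Mathlib

/-! Finite multigraphs are Mathlib's `Graph α β` (vertices in `α`, edges in `β`, parallel edges
allowed); `G.Loopless` forbids loops, `G.Simple` forbids loops and parallel edges. -/

namespace Graph

variable {α β : Type*}

/-- The degree of `v` in a loopless graph: the number of edges incident with `v`. -/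
noncomputable def vertexDegree (G : Graph α β) (v : α) : ℕ :=
  (G.incidenceSet v).ncard

/-- The number of edges between `u` and `v`. -/
noncomputable def numEdges (G : Graph α β) (u v : α) : ℕ :=
  {e | G.IsLink e u v}.ncard

/-- `∂(S)`: the set of edges with precisely one end in `S`. -/
def edgeBoundary (G : Graph α β) (S : Set α) : Set β :=
  {e | ∃ x y, G.IsLink e x y ∧ x ∈ S ∧ y ∉ S}

/-- An `r`-graph: a finite loopless `r`-regular multigraph in which every set of vertices of odd
cardinality has at least `r` boundary edges. -/
structure IsRGraph (G : Graph α β) (r : ℕ) : Prop where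
  finite_vertexSet : V(G).Finite
  finite_edgeSet : E(G).Finite
  loopless : G.Loopless
  regular : ∀ v ∈ V(G), G.vertexDegree v = r
  le_edgeBoundary : ∀ S ⊆ V(G), Odd S.ncard → r ≤ (G.edgeBoundary S).ncard

/-- A perfect matching, as a set of edges: every vertex is incident with exactly one of them. -/
def IsPerfectMatching (G : Graph α β) (M : Set β) : Prop :=
  M ⊆ E(G) ∧ ∀ v ∈ V(G), ∃! e, e ∈ M ∧ G.Inc e v

/-- `G` has a collection of `2r` (not necessarily distinct) perfect matchings such that every edge
is in precisely two of them. -/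
def HasFulkersonCover (G : Graph α β) (r : ℕ) : Prop :=
  ∃ M : Fin (2 * r) → Set β,
    (∀ i, G.IsPerfectMatching (M i)) ∧ ∀ e ∈ E(G), {i | e ∈ M i}.ncard = 2

/-- `G` has a collection of `2r - 1` (not necessarily distinct) perfect matchings such that every
edge is in at least one of them. -/
def HasBergeCover (G : Graph α β) (r : ℕ) : Prop :=
  ∃ M : Fin (2 * r - 1) → Set β,
    (∀ i, G.IsPerfectMatching (M i)) ∧ ∀ e ∈ E(G), ∃ i, e ∈ M i

/-- `T` is a tree: it has no loops and no parallel edges, and is connected and acyclic. -/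
def IsTree (T : Graph α β) : Prop :=
  T.Simple ∧ T.toSimpleGraph.IsTree

/-- `T` is the tree `T_i^r` with root `v`: a tree with all degrees in `{1, r}` in which the root `v`
has degree `r` and every leaf (other than the root, which is a leaf only in the case
`T = K₂`, `r = 1`) has distance `i` to `v`. -/
structure IsBalancedTree (T : Graph α β) (r i : ℕ) (v : V(T)) : Prop where
  isTree : T.IsTree
  degree_mem : ∀ u ∈ V(T), T.vertexDegree u = 1 ∨ T.vertexDegree u = r
  degree_root : T.vertexDegree v = r
  dist_leaf : ∀ u : V(T), u ≠ v → T.vertexDegree u = 1 → T.toSimpleGraph.dist v u = i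

/-- `f` restricts to an automorphism of `G`: a bijection of the vertex set that preserves the number
of edges between any two vertices. (Values of `f` outside `V(G)` are irrelevant.) -/
def IsAutomorphism (G : Graph α β) (f : α → α) : Prop :=
  Set.BijOn f V(G) V(G) ∧
    ∀ u ∈ V(G), ∀ w ∈ V(G), G.numEdges (f u) (f w) = G.numEdges u w

/-- `f` is an automorphism of the tree `T` that is rotational with respect to `v`: it fixes `v`, and
for every other vertex `u` the smallest `k > 0` with `f^k u = u` is the degree of `v`. -/
def IsRotational (T : Graph α β) (v : α) (f : α → α) : Prop :=
  T.IsAutomorphism f ∧ Function.minimalPeriod f v = 1 ∧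
    ∀ u ∈ V(T), u ≠ v → Function.minimalPeriod f u = T.vertexDegree v

/-- A rotation `r`-graph: an `r`-graph that has, for some `i`, a spanning tree `T` isomorphic to
`T_i^r` and an automorphism that is rotational on `T` with respect to the root. -/
def IsRotationRGraph (G : Graph α β) (r : ℕ) : Prop :=
  G.IsRGraph r ∧ ∃ (i : ℕ) (T : Graph α β) (v : V(T)) (f : α → α),
    T ≤s G ∧ T.IsBalancedTree r i v ∧ G.IsAutomorphism f ∧ T.IsRotational v f

end Graph

set_option linter.unusedSectionVars false

/-! The implications 1 → 2 → 4 are immediate: rotation `r`-graphs are `r`-graphs, and a Fulkerson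
cover minus one matching still covers. For `r = 1` the edge set is itself a perfect matching, so the
content is 3 → 1 and 4 → 3 for `r ≥ 3`. Both rest on surgeries that preserve `r`-graphs
(`IsR.subst`, `IsR.glue`) and through which perfect matchings restrict to the pieces. In `subst` an
edge is replaced by an `r`-graph minus an edge; the piece has even order, so a perfect matching
contains both or neither of the two connecting edges. In `glue` two edges whose multiplicities add
up to `r` are deleted and their ends identified; a perfect matching then extends to exactly one of
the two deleted edges, by parity again.

3 → 1: call the `m` parallel copies of an edge a bundle. A Berge cover meets every bundle with `m =
1` at least `2m - 1` times. This bound is raised one multiplicity at a time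
(`HasBundleCovers.succ`): a bundle of size `s + 1` is glued to a Petersen graph with two perfect
matchings thickened, whose bundles of size at most `s` already obey the bound. Counting and a parity
property of Petersen matchings (`petersen_sum_zero_le`) then bound the use of the deleted Petersen
edge from above, hence that of the original bundle from below. At size `r - 1`, replace each edge by
a path of three edges whose middle one has multiplicity `r - 1`. The middle edge is used at least
`2r - 3` times out of `2r - 1`, so the original edge is used at most twice, and what is missing from
the doubled edge set is one further perfect matching.

4 → 3: a cover of a substituted graph restricts to the base and to every piece, so it suffices to
build a simple rotation `r`-graph around a given connected `r`-graph. Choose an edge and a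
breadth-first forest growing from its two ends, and replace every other edge by a gadget that
continues the forest downwards (`Layered.subst`, `exists_gadget`). The tree must end in leaves on
one common level; copies of `K_{r,r}` provide them. The result is itself a gadget. Put it on all rim
edges of a wheel with `r` spokes and `k` parallel edges between consecutive rim vertices, `r = 2k +
1`. Turning the wheel is the required automorphism, and the edges between different levels form the
spanning tree. -/

/-- A finite multigraph with oriented edges, in which the edge `e` has multiplicity `mult e`. -/
structure WGraph (V E : Type) where
  src : E → V
  tgt : E → V
  mult : E → ℕ

namespace WGraph

/-! ### Degrees, cuts and perfect matchings with multiplicities -/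

open Classical in
/-- The indicator function of equality. -/
noncomputable def delta {V : Type} (v w : V) : ℕ := if w = v then 1 else 0

@[simp] lemma delta_self {V : Type} (v : V) : delta v v = 1 := by simp [delta]

lemma delta_of_ne {V : Type} {v w : V} (h : w ≠ v) : delta v w = 0 := by simp [delta, h]

lemma delta_map {V W : Type} {g : V → W} (hg : g.Injective) (v w : V) :
    delta (g v) (g w) = delta v w := by
  by_cases h : w = v
  · simp [h]
  · rw [delta_of_ne h, delta_of_ne (hg.ne h)]

@[simp] lemma delta_inl_inl {V W : Type} (v w : V) :
    delta (Sum.inl v : V ⊕ W) (Sum.inl w) = delta v w :=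
  delta_map Sum.inl_injective v w

@[simp] lemma delta_inr_inr {V W : Type} (v w : W) :
    delta (Sum.inr v : V ⊕ W) (Sum.inr w) = delta v w :=
  delta_map Sum.inr_injective v w

@[simp] lemma delta_inl_inr {V W : Type} (v : V) (w : W) :
    delta (Sum.inl v : V ⊕ W) (Sum.inr w) = 0 := by simp [delta]

@[simp] lemma delta_inr_inl {V W : Type} (v : W) (w : V) :
    delta (Sum.inr v : V ⊕ W) (Sum.inl w) = 0 := by simp [delta]

lemma sum_mul_delta {V : Type} [Fintype V] (g : V → ℕ) (w : V) : ∑ v, g v * delta v w = g w := by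
  classical
  simp [delta]

lemma sum_delta_mul {V : Type} [Fintype V] (g : V → ℕ) (v : V) : ∑ w, g w * delta v w = g v := by
  classical
  simp [delta]

variable {V E : Type} [Fintype E]

/-- The number of elements of `S`. -/
def size [Fintype V] (S : V → Bool) : ℕ := ∑ v, (S v).toNat

/-- The sum of `y` over the edges incident with `v`. -/
noncomputable def wdeg (G : WGraph V E) (y : E → ℕ) (v : V) : ℕ :=
  ∑ e, y e * (delta v (G.src e) + delta v (G.tgt e))

/-- The sum of `y` over the boundary of `S`. -/
def cut (G : WGraph V E) (y : E → ℕ) (S : V → Bool) : ℕ :=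
  ∑ e, y e * (S (G.src e) ^^ S (G.tgt e)).toNat

/-- The weighted version of `Graph.IsRGraph`. -/
structure IsR [Fintype V] (G : WGraph V E) (r : ℕ) : Prop where
  ne : ∀ e, G.src e ≠ G.tgt e
  deg : ∀ v, G.wdeg G.mult v = r
  le_cut : ∀ S : V → Bool, Odd (size S) → r ≤ G.cut G.mult S

/-- Perfect matchings, as functions on the edges. -/
def PM (G : WGraph V E) (x : E → ℕ) : Prop := ∀ v, G.wdeg x v = 1

/-- Double counting of incidences. With `g = 1` the total degree is even, which drives the parity
arguments for both surgeries. -/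
lemma handshake [Fintype V] (G : WGraph V E) (y : E → ℕ) (g : V → ℕ) :
    ∑ v, g v * G.wdeg y v = ∑ e, y e * (g (G.src e) + g (G.tgt e)) := by
  simp only [wdeg, Finset.mul_sum]
  rw [Finset.sum_comm]
  refine Finset.sum_congr rfl fun e _ => ?_
  rw [← sum_mul_delta g (G.src e), ← sum_mul_delta g (G.tgt e), ← Finset.sum_add_distrib,
    Finset.mul_sum]
  exact Finset.sum_congr rfl fun v _ => by ring

lemma PM.le_one {G : WGraph V E} {x : E → ℕ} (h : G.PM x) (e : E) : x e ≤ 1 := by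
  have h1 : x e * (delta (G.src e) (G.src e) + delta (G.src e) (G.tgt e)) ≤ G.wdeg x (G.src e) :=
    Finset.single_le_sum (f := fun e' => x e' * (delta (G.src e) (G.src e') +
      delta (G.src e) (G.tgt e'))) (fun _ _ => Nat.zero_le _) (Finset.mem_univ e)
  rw [h, delta_self] at h1
  nlinarith [Nat.zero_le (x e * delta (G.src e) (G.tgt e))]

/-- The full vertex set has empty boundary, so it cannot be odd. -/
lemma IsR.even_card [Fintype V] {G : WGraph V E} {r : ℕ} (h : G.IsR r) (hr : 0 < r) :
    Even (Fintype.card V) := by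
  by_contra hc
  have := h.le_cut (fun _ => true) (by simpa [size] using hc)
  simp [cut] at this
  omega

/-- An edge in the boundary of an even set has at most half the weight of the boundary. -/
lemma IsR.two_mul_mult_le [Fintype V] {G : WGraph V E} {r : ℕ} (h : G.IsR r) (S : V → Bool)
    (hS : Even (size S)) (e : E) (he : S (G.src e) ≠ S (G.tgt e)) :
    2 * G.mult e ≤ G.cut G.mult S := by
  classical
  set u := G.src e with hu
  set S' := Function.update S u (!S u) with hS'
  have hodd : Odd (size S') := by
    have h1 : size S' + (S u).toNat = size S + (!S u).toNat := by
      unfold size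
      rw [← Finset.add_sum_erase _ _ (Finset.mem_univ u),
        ← Finset.add_sum_erase (a := u) _ (fun v => (S v).toNat) (Finset.mem_univ u)]
      have : ∑ v ∈ Finset.univ.erase u, (S' v).toNat = ∑ v ∈ Finset.univ.erase u, (S v).toNat :=
        Finset.sum_congr rfl fun v hv => by
          rw [hS', Function.update_of_ne (Finset.ne_of_mem_erase hv)]
      rw [this]
      simp [hS']; ring
    obtain ⟨k, hk⟩ := hS
    cases hSu : S u <;> simp [hSu] at h1
    · exact ⟨k, by omega⟩
    · exact ⟨k - 1, by omega⟩
  have h1 := h.le_cut S' hodd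
  -- Flipping `u` exchanges boundary and non-boundary among the edges at `u`. So `e` counts in the
  -- degree of `u` and in the boundary of `S`, but not in that of `S'`.
  have h2 : G.cut G.mult S' + 2 * G.mult e ≤ G.cut G.mult S + G.wdeg G.mult u := by
    have h3 : 2 * G.mult e = ∑ e', G.mult e' * (2 * delta e e') := by
      have := sum_delta_mul (fun e' => 2 * G.mult e') e
      rw [← this]
      exact Finset.sum_congr rfl fun _ _ => by ring
    rw [h3, cut, cut, wdeg, ← Finset.sum_add_distrib, ← Finset.sum_add_distrib]
    refine Finset.sum_le_sum fun e' _ => ?_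
    rw [← mul_add, ← mul_add]
    refine Nat.mul_le_mul_left _ ?_
    have hne := h.ne e'
    by_cases hee : e' = e
    · subst hee
      have h4 : S' (G.tgt e') = S (G.tgt e') := Function.update_of_ne (Ne.symm hne) _ _
      have h5 : S' (G.src e') = !S u := Function.update_self _ _ _
      rw [h4, h5, delta_self, ← hu, delta_self]
      revert he
      cases S u <;> cases S (G.tgt e') <;> simp <;> omega
    · rw [delta_of_ne hee]
      by_cases hs : G.src e' = u
      · have h4 : S' (G.tgt e') = S (G.tgt e') :=
          Function.update_of_ne (fun h => hne (hs.trans h.symm)) _ _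
        rw [hs, delta_self, h4]
        have := Bool.toNat_le (S' u ^^ S (G.tgt e'))
        omega
      · by_cases ht : G.tgt e' = u
        · rw [ht, delta_self]
          have := Bool.toNat_le (S' (G.src e') ^^ S' u)
          omega
        · rw [hS', Function.update_of_ne hs, Function.update_of_ne ht]
          omega
  rw [h.deg] at h2
  omega

/-- Summing a function that is changed at one place. -/
lemma sum_ite_eq_add [DecidableEq E] (f : E) (a b : E → ℕ) :
    ∑ k, (if k = f then a k else b k) + b f = ∑ k, b k + a f := by
  rw [← Finset.add_sum_erase _ _ (Finset.mem_univ f),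
    ← Finset.add_sum_erase _ b (Finset.mem_univ f)]
  have : ∑ k ∈ Finset.univ.erase f, (if k = f then a k else b k)
      = ∑ k ∈ Finset.univ.erase f, b k :=
    Finset.sum_congr rfl fun k hk => if_neg (Finset.ne_of_mem_erase hk)
  rw [this]
  simp; ring


/-! ### Substitution of `r`-graphs for edges -/

section subst

variable {V E₀ I : Type} {VK EK : I → Type}

open Classical in
/-- Replace every edge `e = inr i` of `B` by a copy of `K i` minus `f i`: the edges `e` and `f i`
exchange their targets. -/
noncomputable def subst (B : WGraph V (E₀ ⊕ I)) (K : ∀ i, WGraph (VK i) (EK i)) (f : ∀ i, EK i) :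
    WGraph (V ⊕ Σ i, VK i) ((E₀ ⊕ I) ⊕ Σ i, EK i) where
  src := Sum.elim (fun e => .inl (B.src e)) (fun p => .inr ⟨p.1, (K p.1).src p.2⟩)
  tgt := Sum.elim
    (Sum.elim (fun e => .inl (B.tgt (.inl e))) (fun i => .inr ⟨i, (K i).tgt (f i)⟩))
    (fun p => if p.2 = f p.1 then .inl (B.tgt (.inr p.1)) else .inr ⟨p.1, (K p.1).tgt p.2⟩)
  mult := Sum.elim B.mult (fun p => (K p.1).mult p.2)

variable (B : WGraph V (E₀ ⊕ I)) (K : ∀ i, WGraph (VK i) (EK i)) (f : ∀ i, EK i)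

@[simp] lemma subst_src_inl (e) : (subst B K f).src (.inl e) = .inl (B.src e) := rfl
@[simp] lemma subst_src_inr (i k) :
    (subst B K f).src (.inr ⟨i, k⟩) = .inr ⟨i, (K i).src k⟩ := rfl
@[simp] lemma subst_tgt_inl_inl (e) :
    (subst B K f).tgt (.inl (.inl e)) = .inl (B.tgt (.inl e)) := rfl
@[simp] lemma subst_tgt_inl_inr (i) :
    (subst B K f).tgt (.inl (.inr i)) = .inr ⟨i, (K i).tgt (f i)⟩ := rfl
@[simp] lemma subst_tgt_inr_self (i) :
    (subst B K f).tgt (.inr ⟨i, f i⟩) = .inl (B.tgt (.inr i)) := by simp [subst]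
lemma subst_tgt_inr_of_ne {i k} (h : k ≠ f i) :
    (subst B K f).tgt (.inr ⟨i, k⟩) = .inr ⟨i, (K i).tgt k⟩ := by simp [subst, h]
@[simp] lemma subst_mult_inl (e) : (subst B K f).mult (.inl e) = B.mult e := rfl
@[simp] lemma subst_mult_inr (i k) :
    (subst B K f).mult (.inr ⟨i, k⟩) = (K i).mult k := rfl

variable [Fintype E₀] [Fintype I] [∀ i, Fintype (EK i)]

lemma sum_mul_delta_sigma {VK : I → Type} {X : I → Type} [∀ i, Fintype (X i)]
    (y : ∀ i, X i → ℕ) (g : ∀ i, X i → VK i) (i : I) (p : VK i) :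
    ∑ j, ∑ k, y j k * delta (⟨i, p⟩ : Σ i, VK i) ⟨j, g j k⟩ = ∑ k, y i k * delta p (g i k) := by
  rw [Finset.sum_eq_single i]
  · refine Finset.sum_congr rfl fun k _ => ?_
    rw [delta_map sigma_mk_injective]
  · intro j _ hj
    refine Finset.sum_eq_zero fun k _ => ?_
    rw [delta_of_ne (fun h => hj (congrArg Sigma.fst h)), mul_zero]
  · simp

/-- Exchanging targets in a sum over all edges. -/
lemma subst_sum_tgt_inr (y : (Σ i, EK i) → ℕ) (F : (V ⊕ Σ i, VK i) → ℕ) (i : I) :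
    ∑ k, y ⟨i, k⟩ * F ((subst B K f).tgt (.inr ⟨i, k⟩)) + y ⟨i, f i⟩ * F (.inr ⟨i, (K i).tgt (f i)⟩)
      = ∑ k, y ⟨i, k⟩ * F (.inr ⟨i, (K i).tgt k⟩) + y ⟨i, f i⟩ * F (.inl (B.tgt (.inr i))) := by
  classical
  have := sum_ite_eq_add (f i) (fun k => y ⟨i, k⟩ * F (.inl (B.tgt (.inr i))))
    (fun k => y ⟨i, k⟩ * F (.inr ⟨i, (K i).tgt k⟩))
  rw [← this]
  congr 1
  refine Finset.sum_congr rfl fun k _ => ?_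
  split_ifs with h
  · rw [h, subst_tgt_inr_self]
  · rw [subst_tgt_inr_of_ne _ _ _ h]

/-- Only the target of `f i` changes its incidences inside the piece: it loses `f i` and gains the
edge `inr i`. The additive form avoids truncated subtraction. -/
lemma subst_wdeg_inr (x : (E₀ ⊕ I) ⊕ (Σ i, EK i) → ℕ) (i : I) (p : VK i) :
    (subst B K f).wdeg x (.inr ⟨i, p⟩) + x (.inr ⟨i, f i⟩) * delta p ((K i).tgt (f i))
      = (K i).wdeg (fun k => x (.inr ⟨i, k⟩)) p
        + x (.inl (.inr i)) * delta p ((K i).tgt (f i)) := by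
  have h1 : (subst B K f).wdeg x (.inr ⟨i, p⟩) =
      ∑ j, x (.inl (.inr j)) * delta (⟨i, p⟩ : Σ i, VK i) ⟨j, (K j).tgt (f j)⟩ +
      (∑ j, ∑ k, x (.inr ⟨j, k⟩) * delta (⟨i, p⟩ : Σ i, VK i) ⟨j, (K j).src k⟩ +
      ∑ j, ∑ k, x (.inr ⟨j, k⟩) *
        delta (Sum.inr ⟨i, p⟩) ((subst B K f).tgt (.inr ⟨j, k⟩))) := by
    simp only [wdeg, Fintype.sum_sum_type, Fintype.sum_sigma, subst_src_inl, subst_src_inr,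
      subst_tgt_inl_inl, subst_tgt_inl_inr, delta_inr_inr, delta_inr_inl, mul_add,
      Finset.sum_add_distrib]
    simp
    ring
  have h2 := sum_mul_delta_sigma (VK := VK) (fun j (_ : Unit) => x (.inl (.inr j)))
    (fun j _ => (K j).tgt (f j)) i p
  have h3 := sum_mul_delta_sigma (VK := VK) (fun j k => x (.inr ⟨j, k⟩))
    (fun j k => (K j).src k) i p
  have h4 : ∑ j, ∑ k, x (.inr ⟨j, k⟩) *
        delta (Sum.inr ⟨i, p⟩) ((subst B K f).tgt (.inr ⟨j, k⟩))
      = ∑ k, x (.inr ⟨i, k⟩) *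
        delta (Sum.inr ⟨i, p⟩) ((subst B K f).tgt (.inr ⟨i, k⟩)) := by
    refine Finset.sum_eq_single i (fun j _ hj => Finset.sum_eq_zero fun k _ => ?_) (by simp)
    by_cases hk : k = f j
    · subst hk; simp
    · rw [subst_tgt_inr_of_ne _ _ _ hk, delta_inr_inr,
        delta_of_ne (fun h => hj (congrArg Sigma.fst h)), mul_zero]
  have h5 := subst_sum_tgt_inr B K f (fun q => x (.inr q)) (delta (.inr ⟨i, p⟩)) i
  simp only [delta_inr_inr, delta_inr_inl, mul_zero, add_zero,
    delta_map (sigma_mk_injective (i := i))] at h5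
  simp only [Finset.univ_unique, Finset.sum_singleton] at h2
  rw [h1, h2, h3, h4]
  simp only [wdeg, mul_add, Finset.sum_add_distrib]
  omega

lemma subst_wdeg_inl (x : (E₀ ⊕ I) ⊕ (Σ i, EK i) → ℕ)
    (hx : ∀ i, x (.inl (.inr i)) = x (.inr ⟨i, f i⟩)) (v : V) :
    (subst B K f).wdeg x (.inl v) = B.wdeg (fun e => x (.inl e)) v := by
  have h4 : ∀ i, ∑ k, x (.inr ⟨i, k⟩) *
        delta (Sum.inl v) ((subst B K f).tgt (.inr ⟨i, k⟩))
      = x (.inl (.inr i)) * delta v (B.tgt (.inr i)) := fun i => by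
    have h5 := subst_sum_tgt_inr B K f (fun q => x (.inr q)) (delta (.inl v)) i
    simpa [hx] using h5
  simp only [wdeg, Fintype.sum_sum_type, Fintype.sum_sigma, subst_src_inl, subst_src_inr,
      subst_tgt_inl_inl, subst_tgt_inl_inr, delta_inl_inr, delta_inl_inl, mul_add,
      Finset.sum_add_distrib, h4]
  simp

variable {B K f} [Fintype V] [∀ i, Fintype (VK i)]

/-- The piece has even order, so the number of its vertices matched to the outside is even: the two
connecting edges are both used or both unused. -/
lemma PM.subst_eq {r : ℕ} (hr : 0 < r) (hK : ∀ i, (K i).IsR r)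
    {x : (E₀ ⊕ I) ⊕ (Σ i, EK i) → ℕ} (hx : (subst B K f).PM x) (i : I) :
    x (.inl (.inr i)) = x (.inr ⟨i, f i⟩) := by
  have h1 := hx.le_one (.inl (.inr i))
  have h2 := hx.le_one (.inr ⟨i, f i⟩)
  have h3 := (K i).handshake (fun k => x (.inr ⟨i, k⟩)) (fun _ => 1)
  have h4 : ∑ p, ((subst B K f).wdeg x (.inr ⟨i, p⟩) +
      x (.inr ⟨i, f i⟩) * delta p ((K i).tgt (f i))) = ∑ p,
      ((K i).wdeg (fun k => x (.inr ⟨i, k⟩)) p + x (.inl (.inr i)) * delta p ((K i).tgt (f i))) :=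
    Finset.sum_congr rfl fun p _ => subst_wdeg_inr B K f x i p
  simp only [Finset.sum_add_distrib, hx _, sum_mul_delta (fun _ => x (.inr ⟨i, f i⟩)),
    sum_mul_delta (fun _ => x (.inl (.inr i)))] at h4
  simp only [one_mul, ← Finset.sum_mul] at h3
  obtain ⟨c, hc⟩ := (hK i).even_card hr
  simp only [Finset.sum_const, Finset.card_univ, smul_eq_mul, mul_one, hc] at h4
  omega

lemma PM.subst_base {r : ℕ} (hr : 0 < r) (hK : ∀ i, (K i).IsR r)
    {x : (E₀ ⊕ I) ⊕ (Σ i, EK i) → ℕ} (hx : (subst B K f).PM x) :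
    B.PM (fun e => x (.inl e)) := fun v => by
  rw [← subst_wdeg_inl B K f x (hx.subst_eq hr hK), hx]

lemma PM.subst_gadget {r : ℕ} (hr : 0 < r) (hK : ∀ i, (K i).IsR r)
    {x : (E₀ ⊕ I) ⊕ (Σ i, EK i) → ℕ} (hx : (subst B K f).PM x) (i : I) :
    (K i).PM (fun k => x (.inr ⟨i, k⟩)) := fun p => by
  have := subst_wdeg_inr B K f x i p
  rw [hx, hx.subst_eq hr hK] at this
  omega

/-- The boundary of a set after substitution. -/
lemma subst_cut (S : (V ⊕ Σ i, VK i) → Bool) (hB : ∀ i, B.mult (.inr i) = 1)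
    (hf : ∀ i, (K i).mult (f i) = 1) :
    (subst B K f).cut (subst B K f).mult S =
      ∑ e, B.mult (.inl e) * (S (.inl (B.src (.inl e))) ^^ S (.inl (B.tgt (.inl e)))).toNat +
      ∑ i, ((S (.inl (B.src (.inr i))) ^^ S (.inr ⟨i, (K i).tgt (f i)⟩)).toNat +
        (S (.inr ⟨i, (K i).src (f i)⟩) ^^ S (.inl (B.tgt (.inr i)))).toNat +
        ((K i).cut (K i).mult (fun p => S (.inr ⟨i, p⟩)) -
        (S (.inr ⟨i, (K i).src (f i)⟩) ^^ S (.inr ⟨i, (K i).tgt (f i)⟩)).toNat)) := by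
  classical
  have key : ∀ i, ∑ k, (K i).mult k *
      (S (.inr ⟨i, (K i).src k⟩) ^^ S ((subst B K f).tgt (.inr ⟨i, k⟩))).toNat =
      (S (.inr ⟨i, (K i).src (f i)⟩) ^^ S (.inl (B.tgt (.inr i)))).toNat +
        ((K i).cut (K i).mult (fun p => S (.inr ⟨i, p⟩)) -
        (S (.inr ⟨i, (K i).src (f i)⟩) ^^ S (.inr ⟨i, (K i).tgt (f i)⟩)).toNat) := fun i => by
    have h1 := sum_ite_eq_add (f i)
      (fun k => (K i).mult k * (S (.inr ⟨i, (K i).src k⟩) ^^ S (.inl (B.tgt (.inr i)))).toNat)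
      (fun k => (K i).mult k *
        (S (.inr ⟨i, (K i).src k⟩) ^^ S (.inr ⟨i, (K i).tgt k⟩)).toNat)
    have h2 : ∑ k, (K i).mult k *
      (S (.inr ⟨i, (K i).src k⟩) ^^ S ((subst B K f).tgt (.inr ⟨i, k⟩))).toNat =
      ∑ k, (if k = f i then
        (K i).mult k * (S (.inr ⟨i, (K i).src k⟩) ^^ S (.inl (B.tgt (.inr i)))).toNat
        else (K i).mult k *
          (S (.inr ⟨i, (K i).src k⟩) ^^ S (.inr ⟨i, (K i).tgt k⟩)).toNat) := by
      refine Finset.sum_congr rfl fun k _ => ?_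
      split_ifs with h
      · rw [h, subst_tgt_inr_self]
      · rw [subst_tgt_inr_of_ne _ _ _ h]
    have h3 : (K i).mult (f i) *
        (S (.inr ⟨i, (K i).src (f i)⟩) ^^ S (.inr ⟨i, (K i).tgt (f i)⟩)).toNat ≤
        (K i).cut (K i).mult (fun p => S (.inr ⟨i, p⟩)) :=
      Finset.single_le_sum (f := fun k => (K i).mult k *
        (S (.inr ⟨i, (K i).src k⟩) ^^ S (.inr ⟨i, (K i).tgt k⟩)).toNat)
        (fun _ _ => Nat.zero_le _) (Finset.mem_univ (f i))
    have h4 : (K i).cut (K i).mult (fun p => S (.inr ⟨i, p⟩)) = ∑ k, (K i).mult k *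
        (S (.inr ⟨i, (K i).src k⟩) ^^ S (.inr ⟨i, (K i).tgt k⟩)).toNat := rfl
    rw [h2]
    rw [hf, one_mul] at h3
    rw [hf, one_mul, one_mul] at h1
    omega
  simp only [cut, Fintype.sum_sum_type, Fintype.sum_sigma, subst_src_inl, subst_src_inr,
      subst_tgt_inl_inl, subst_tgt_inl_inr, subst_mult_inl, subst_mult_inr, hB, one_mul] at key ⊢
  simp only [key, Finset.sum_add_distrib]
  ring

/-- If an odd set is odd on the base, each piece contributes at least as much as the edge it
replaces. Otherwise it is odd on some piece, which loses at most two boundary edges, and these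
losses are made up by the rest of the graph. -/
theorem IsR.subst {r : ℕ} (hr : 2 ≤ r) (hBR : B.IsR r) (hK : ∀ i, (K i).IsR r)
    (hB : ∀ i, B.mult (.inr i) = 1) (hf : ∀ i, (K i).mult (f i) = 1) :
    (subst B K f).IsR r where
  ne := by
    rintro ((e | i) | ⟨i, k⟩)
    · simpa using hBR.ne _
    · simp
    · by_cases h : k = f i
      · subst h; simp
      · rw [subst_tgt_inr_of_ne _ _ _ h]
        simpa using (hK i).ne k
  deg := by
    rintro (v | ⟨i, p⟩)
    · rw [subst_wdeg_inl _ _ _ _ (by simp [hB, hf])]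
      exact hBR.deg v
    · have := subst_wdeg_inr B K f (WGraph.subst B K f).mult i p
      simp only [subst_mult_inr, subst_mult_inl, hB, hf, add_left_inj] at this
      rw [this]
      exact (hK i).deg p
  le_cut := by
    intro S hS
    rw [subst_cut S hB hf]
    have hle : ∀ i, (S (.inr ⟨i, (K i).src (f i)⟩) ^^ S (.inr ⟨i, (K i).tgt (f i)⟩)).toNat ≤
        (K i).cut (K i).mult (fun p => S (.inr ⟨i, p⟩)) := fun i => by
      have := Finset.single_le_sum (f := fun k => (K i).mult k *
        (S (.inr ⟨i, (K i).src k⟩) ^^ S (.inr ⟨i, (K i).tgt k⟩)).toNat)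
        (fun _ _ => Nat.zero_le _) (Finset.mem_univ (f i))
      simpa [hf, cut] using this
    have hodd : ∀ i, Odd (size (fun p => S (.inr ⟨i, p⟩))) →
        r ≤ (K i).cut (K i).mult (fun p => S (.inr ⟨i, p⟩)) := fun i => (hK i).le_cut _
    have htwo : ∀ i, S (.inr ⟨i, (K i).src (f i)⟩) ≠ S (.inr ⟨i, (K i).tgt (f i)⟩) →
        2 ≤ (K i).cut (K i).mult (fun p => S (.inr ⟨i, p⟩)) := fun i h => by
      by_cases ho : Odd (size (fun p => S (.inr ⟨i, p⟩)))
      · exact hr.trans (hodd i ho)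
      · have := (hK i).two_mul_mult_le _ (Nat.not_odd_iff_even.1 ho) (f i) h
        simpa [hf] using this
    -- If the replaced edge crosses but neither connecting edge does, the ends of `f i` are
    -- separated; then the piece has boundary at least 2, of which only `f i` is lost.
    have hterm : ∀ i, (S (.inl (B.src (.inr i))) ^^ S (.inl (B.tgt (.inr i)))).toNat ≤
        (S (.inl (B.src (.inr i))) ^^ S (.inr ⟨i, (K i).tgt (f i)⟩)).toNat +
        (S (.inr ⟨i, (K i).src (f i)⟩) ^^ S (.inl (B.tgt (.inr i)))).toNat +
        ((K i).cut (K i).mult (fun p => S (.inr ⟨i, p⟩)) -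
        (S (.inr ⟨i, (K i).src (f i)⟩) ^^ S (.inr ⟨i, (K i).tgt (f i)⟩)).toNat) := fun i => by
      have h1 := hle i
      have h2 := htwo i
      revert h1 h2
      generalize (K i).cut _ _ = c
      cases S (.inl (B.src (.inr i))) <;> cases S (.inl (B.tgt (.inr i))) <;>
      cases S (.inr ⟨i, (K i).src (f i)⟩) <;> cases S (.inr ⟨i, (K i).tgt (f i)⟩) <;>
      simp <;> omega
    set q : I → ℕ := fun i => (S (.inl (B.src (.inr i))) ^^ S (.inr ⟨i, (K i).tgt (f i)⟩)).toNat +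
        (S (.inr ⟨i, (K i).src (f i)⟩) ^^ S (.inl (B.tgt (.inr i)))).toNat +
        ((K i).cut (K i).mult (fun p => S (.inr ⟨i, p⟩)) -
        (S (.inr ⟨i, (K i).src (f i)⟩) ^^ S (.inr ⟨i, (K i).tgt (f i)⟩)).toNat) with hq
    set b : I → ℕ := fun i => (S (.inl (B.src (.inr i))) ^^ S (.inl (B.tgt (.inr i)))).toNat with hb
    have hcutB : B.cut B.mult (fun v => S (.inl v)) =
        ∑ e, B.mult (.inl e) * (S (.inl (B.src (.inl e))) ^^ S (.inl (B.tgt (.inl e)))).toNat +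
        ∑ i, b i := by
      simp [cut, hB, hb]
    by_cases hSB : Odd (size (fun v => S (.inl v)))
    · refine (hBR.le_cut _ hSB).trans ?_
      rw [hcutB]
      exact Nat.add_le_add_left (Finset.sum_le_sum fun i _ => hterm i) _
    · have hex : ∃ i, Odd (size (fun p => S (.inr ⟨i, p⟩))) := by
        by_contra hcon
        push Not at hcon
        have h1 : size S = size (fun v => S (.inl v)) + ∑ i, size (fun p => S (.inr ⟨i, p⟩)) := by
          simp [size, Fintype.sum_sum_type, Fintype.sum_sigma]
        have h2 : Even (∑ i, size (fun p => S (.inr ⟨i, p⟩))) :=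
          Finset.even_sum _ fun i _ => Nat.not_odd_iff_even.1 (hcon i)
        rw [h1, ← Nat.not_even_iff_odd] at hS
        exact hS ((Nat.not_odd_iff_even.1 hSB).add h2)
      obtain ⟨i, hi⟩ := hex
      have h1 := hodd i hi
      have h2 : S (.inl (B.src (.inr i))) ≠ S (.inl (B.tgt (.inr i))) →
          2 ≤ B.cut B.mult (fun v => S (.inl v)) := fun h => by
        have := hBR.two_mul_mult_le _ (Nat.not_odd_iff_even.1 hSB) (.inr i) h
        simpa [hB] using this
      classical
      have h3 : ∑ j, b j + q i ≤ ∑ j, q j + b i := by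
        rw [← Finset.add_sum_erase _ _ (Finset.mem_univ i),
          ← Finset.add_sum_erase _ q (Finset.mem_univ i)]
        have : ∑ j ∈ Finset.univ.erase i, b j ≤ ∑ j ∈ Finset.univ.erase i, q j :=
          Finset.sum_le_sum fun j _ => hterm j
        omega
      rw [hcutB] at h2
      change r ≤ _ + ∑ j, q j
      -- The piece may fall one short of `r` when the base edge crosses. The base then has an even
      -- set with a boundary of at least 2, so an edge other than `inr i` pays the difference.
      have h4 : r + b i ≤ q i + (if S (.inl (B.src (.inr i))) = S (.inl (B.tgt (.inr i)))
          then 0 else 2) := by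
        rw [hb, hq]
        revert h1
        simp only
        generalize (K i).cut _ _ = c
        cases S (.inl (B.src (.inr i))) <;> cases S (.inl (B.tgt (.inr i))) <;>
        cases S (.inr ⟨i, (K i).src (f i)⟩) <;> cases S (.inr ⟨i, (K i).tgt (f i)⟩) <;>
        simp <;> omega
      split_ifs at h4 with hsplit
      · omega
      · have := h2 hsplit
        omega

end subst

/-! ### Gluing two `r`-graphs along deleted edges -/

section glue

variable {VH VK EH EK : Type}

open Classical in
/-- The map on vertices of `K` that identifies the ends of `f` with those of `e`. -/
noncomputable def glueMap (H : WGraph VH EH) (K : WGraph VK EK) (e : EH) (f : EK) (p : VK) :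
    VH ⊕ VK :=
  if p = K.src f then .inl (H.src e) else if p = K.tgt f then .inl (H.tgt e) else .inr p

open Classical in
/-- Delete `e` from `H` and `f` from `K` and identify the ends of `e` with the ends of `f`.
The edges `e` and `f` are kept, as a separate component on the old ends of `f`. -/
noncomputable def glue (H : WGraph VH EH) (K : WGraph VK EK) (e : EH) (f : EK) :
    WGraph (VH ⊕ VK) (EH ⊕ EK) where
  src := Sum.elim (fun a => if a = e then .inr (K.src f) else .inl (H.src a))
    (fun k => if k = f then .inr (K.src f) else glueMap H K e f (K.src k))
  tgt := Sum.elim (fun a => if a = e then .inr (K.tgt f) else .inl (H.tgt a))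
    (fun k => if k = f then .inr (K.tgt f) else glueMap H K e f (K.tgt k))
  mult := Sum.elim H.mult K.mult

variable {H : WGraph VH EH} {K : WGraph VK EK} {e : EH} {f : EK}

@[simp] lemma glueMap_src : glueMap H K e f (K.src f) = .inl (H.src e) := by simp [glueMap]

lemma glueMap_tgt (h : K.src f ≠ K.tgt f) : glueMap H K e f (K.tgt f) = .inl (H.tgt e) := by
  simp [glueMap, h.symm]

lemma glueMap_of_ne {p : VK} (h : p ≠ K.src f) (h' : p ≠ K.tgt f) :
    glueMap H K e f p = .inr p := by simp [glueMap, h, h']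

variable [Fintype EH] [Fintype EK]

/-- A single identity for degrees and cuts, which are sums of this form for suitable `Q`. The
correction terms move `e` and `f` from the identified ends to the separate component. -/
lemma glue_sum (h : K.src f ≠ K.tgt f) (y : EH ⊕ EK → ℕ) (Q : VH ⊕ VK → VH ⊕ VK → ℕ) :
    ∑ a, y a * Q ((glue H K e f).src a) ((glue H K e f).tgt a) +
      (y (.inl e) + y (.inr f)) * Q (.inl (H.src e)) (.inl (H.tgt e)) =
    ∑ a, y (.inl a) * Q (.inl (H.src a)) (.inl (H.tgt a)) +
      ∑ k, y (.inr k) * Q (glueMap H K e f (K.src k)) (glueMap H K e f (K.tgt k)) +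
      (y (.inl e) + y (.inr f)) * Q (.inr (K.src f)) (.inr (K.tgt f)) := by
  classical
  have h1 := sum_ite_eq_add e (fun a => y (.inl a) * Q (.inr (K.src f)) (.inr (K.tgt f)))
    (fun a => y (.inl a) * Q (.inl (H.src a)) (.inl (H.tgt a)))
  have h2 := sum_ite_eq_add f (fun k => y (.inr k) * Q (.inr (K.src f)) (.inr (K.tgt f)))
    (fun k => y (.inr k) * Q (glueMap H K e f (K.src k)) (glueMap H K e f (K.tgt k)))
  have h3 : ∑ a, y a * Q ((glue H K e f).src a) ((glue H K e f).tgt a) =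
      ∑ a, (if a = e then y (.inl a) * Q (.inr (K.src f)) (.inr (K.tgt f)) else
        y (.inl a) * Q (.inl (H.src a)) (.inl (H.tgt a))) +
      ∑ k, (if k = f then y (.inr k) * Q (.inr (K.src f)) (.inr (K.tgt f)) else
        y (.inr k) * Q (glueMap H K e f (K.src k)) (glueMap H K e f (K.tgt k))) := by
    rw [Fintype.sum_sum_type]
    congr 1
    · refine Finset.sum_congr rfl fun a _ => ?_
      by_cases ha : a = e <;> simp [glue, ha]
    · refine Finset.sum_congr rfl fun k _ => ?_
      by_cases hk : k = f <;> simp [glue, hk]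
  rw [glueMap_tgt h, glueMap_src] at h2
  rw [h3, add_mul, add_mul]
  omega

lemma glue_wdeg_inl (h : K.src f ≠ K.tgt f) (y : EH ⊕ EK → ℕ) (p : VH) :
    (glue H K e f).wdeg y (.inl p) +
      (y (.inl e) + y (.inr f)) * (delta p (H.src e) + delta p (H.tgt e)) =
    H.wdeg (fun a => y (.inl a)) p +
      (delta p (H.src e) * K.wdeg (fun k => y (.inr k)) (K.src f) +
       delta p (H.tgt e) * K.wdeg (fun k => y (.inr k)) (K.tgt f)) := by
  have hφ : ∀ q, delta (Sum.inl p) (glueMap H K e f q) =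
      delta p (H.src e) * delta (K.src f) q + delta p (H.tgt e) * delta (K.tgt f) q := by
    intro q
    by_cases h1 : q = K.src f
    · subst h1; simp [delta_of_ne h]
    · by_cases h2 : q = K.tgt f
      · subst h2; simp [delta_of_ne h.symm, glueMap_tgt h]
      · simp [glueMap_of_ne h1 h2, delta_of_ne h1, delta_of_ne h2]
  have := glue_sum (H := H) (e := e) h y (fun a b => delta (.inl p) a + delta (.inl p) b)
  simp only [delta_inl_inl, delta_inl_inr, add_zero, mul_zero, hφ] at this
  rw [wdeg, this, wdeg, wdeg, wdeg, Finset.mul_sum, Finset.mul_sum, ← Finset.sum_add_distrib]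
  congr 1
  exact Finset.sum_congr rfl fun k _ => by ring

lemma glue_wdeg_inr (h : K.src f ≠ K.tgt f) (y : EH ⊕ EK → ℕ) (q : VK) (h1 : q ≠ K.src f)
    (h2 : q ≠ K.tgt f) :
    (glue H K e f).wdeg y (.inr q) = K.wdeg (fun k => y (.inr k)) q := by
  have hφ : ∀ q', delta (Sum.inr q) (glueMap H K e f q') = delta q q' := by
    intro q'
    by_cases h3 : q' = K.src f
    · subst h3; simp [delta_of_ne h1.symm]
    · by_cases h4 : q' = K.tgt f
      · subst h4; simp [delta_of_ne h2.symm, glueMap_tgt h]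
      · simp [glueMap_of_ne h3 h4]
  have := glue_sum (H := H) (e := e) h y (fun a b => delta (.inr q) a + delta (.inr q) b)
  rw [wdeg, wdeg]
  simpa only [hφ, delta_inr_inr, delta_inr_inl, delta_of_ne h1.symm, delta_of_ne h2.symm, add_zero,
    mul_zero, Finset.sum_const_zero, zero_add] using this

lemma glue_wdeg_ends (h : K.src f ≠ K.tgt f) (y : EH ⊕ EK → ℕ) (q : VK)
    (hq : q = K.src f ∨ q = K.tgt f) :
    (glue H K e f).wdeg y (.inr q) = y (.inl e) + y (.inr f) := by
  have hφ : ∀ q', delta (Sum.inr q) (glueMap H K e f q') = 0 := by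
    intro q'
    by_cases h3 : q' = K.src f
    · subst h3; simp
    · by_cases h4 : q' = K.tgt f
      · subst h4; simp [glueMap_tgt h]
      · rw [glueMap_of_ne h3 h4, delta_inr_inr, delta_of_ne]
        rintro rfl
        tauto
  have := glue_sum (H := H) (e := e) h y (fun a b => delta (.inr q) a + delta (.inr q) b)
  rw [wdeg]
  rcases hq with rfl | rfl
  · simpa [hφ, delta_of_ne h.symm] using this
  · simpa [hφ, delta_of_ne h] using this

variable [Fintype VH] [Fintype VK]

lemma size_add_delta (S : VK → Bool) (φS : VK → Bool) (x y : VK) (hxy : x ≠ y)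
    (h : ∀ p, p ≠ x → p ≠ y → φS p = S p) :
    size φS + (S x).toNat + (S y).toNat = size S + (φS x).toNat + (φS y).toNat := by
  classical
  unfold size
  have hy : y ∈ Finset.univ.erase x := by simp [hxy.symm]
  rw [← Finset.add_sum_erase _ _ (Finset.mem_univ x), ← Finset.add_sum_erase _ _ hy,
    ← Finset.add_sum_erase (a := x) _ (fun v => (S v).toNat) (Finset.mem_univ x),
    ← Finset.add_sum_erase _ (fun v => (S v).toNat) hy]
  have : ∑ v ∈ (Finset.univ.erase x).erase y, (φS v).toNat
      = ∑ v ∈ (Finset.univ.erase x).erase y, (S v).toNat :=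
    Finset.sum_congr rfl fun v hv => by
      simp only [Finset.mem_erase] at hv
      rw [h v hv.2.1 hv.1]
  rw [this]
  ring

/-- If the separate component is split, it alone contributes `r`. Otherwise let `A` and `D` be the
traces of the set on `H` and `K`. When the identified ends lie on one side, `A` or `D` is odd and
nothing is lost. When they are separated, the deleted edges cost `r`, and `A` and `D` have equal
parity: both odd gives `2r`, both even gives `2 * H.mult e + 2 * K.mult f = 2r`. -/
theorem IsR.glue {r : ℕ} (hH : H.IsR r) (hK : K.IsR r)
    (hm : H.mult e + K.mult f = r) : (glue H K e f).IsR r where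
  ne := by
    have hinj : ∀ p q, glueMap H K e f p = glueMap H K e f q → p = q := by
      intro p q
      have := hH.ne e
      have := (hH.ne e).symm
      unfold glueMap
      split_ifs <;> simp_all
    rintro (a | k)
    · by_cases ha : a = e
      · simpa [WGraph.glue, ha] using hK.ne f
      · simpa [WGraph.glue, ha] using hH.ne a
    · by_cases hk : k = f
      · simpa [WGraph.glue, hk] using hK.ne f
      · simp only [WGraph.glue, Sum.elim_inr, hk, if_false]
        exact fun h => hK.ne k (hinj _ _ h)
  deg := by
    have hne := hK.ne f
    rintro (p | q)
    · have := glue_wdeg_inl (H := H) (e := e) hne (WGraph.glue H K e f).mult p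
      have h1 : H.wdeg (fun a => (WGraph.glue H K e f).mult (.inl a)) p = r := hH.deg p
      have h2 : ∀ q, K.wdeg (fun a => (WGraph.glue H K e f).mult (.inr a)) q = r := hK.deg
      have h3 : (WGraph.glue H K e f).mult (.inl e) + (WGraph.glue H K e f).mult (.inr f) = r := hm
      rw [h1, h2, h2, h3] at this
      linarith
    · by_cases hq : q = K.src f ∨ q = K.tgt f
      · rw [glue_wdeg_ends hne _ _ hq]
        exact hm
      · push Not at hq
        rw [glue_wdeg_inr hne _ _ hq.1 hq.2]
        exact hK.deg q
  le_cut := by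
    intro S hS
    have hne := hK.ne f
    set A : VH → Bool := fun p => S (.inl p) with hA
    set D : VK → Bool := fun q => S (glueMap H K e f q) with hD
    have hDx : D (K.src f) = A (H.src e) := by simp [hD, hA]
    have hDy : D (K.tgt f) = A (H.tgt e) := by simp [hD, hA, glueMap_tgt hne]
    have hsum := glue_sum (H := H) (e := e) hne (WGraph.glue H K e f).mult
      (fun a b => (S a ^^ S b).toNat)
    have h3 : (WGraph.glue H K e f).mult (.inl e) + (WGraph.glue H K e f).mult (.inr f) = r := hm
    rw [h3] at hsum
    change (WGraph.glue H K e f).cut (WGraph.glue H K e f).mult S +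
      r * (A (H.src e) ^^ A (H.tgt e)).toNat = H.cut H.mult A + K.cut K.mult D +
      r * (S (.inr (K.src f)) ^^ S (.inr (K.tgt f))).toNat at hsum
    have hsize := size_add_delta (fun q => S (.inr q)) D (K.src f) (K.tgt f) hne
      (fun p h h' => by simp [hD, glueMap_of_ne h h'])
    have hsize' : size S = size A + size (fun q => S (.inr q)) := by
      simp [size, Fintype.sum_sum_type, hA]
    rw [hDx, hDy] at hsize
    have hAo : Odd (size A) → r ≤ H.cut H.mult A := hH.le_cut A
    have hDo : Odd (size D) → r ≤ K.cut K.mult D := hK.le_cut D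
    have hAe : Even (size A) → A (H.src e) ≠ A (H.tgt e) → 2 * H.mult e ≤ H.cut H.mult A :=
      fun h1 h2 => hH.two_mul_mult_le A h1 e h2
    have hDe : Even (size D) → A (H.src e) ≠ A (H.tgt e) → 2 * K.mult f ≤ K.cut K.mult D :=
      fun h1 h2 => hK.two_mul_mult_le D h1 f (by rwa [hDx, hDy])
    rw [Nat.odd_iff] at hS hAo hDo
    rw [Nat.even_iff] at hAe hDe
    revert hsum hsize hAe hDe
    generalize S (.inr (K.src f)) = b₁
    generalize S (.inr (K.tgt f)) = b₂
    generalize A (H.src e) = b₃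
    generalize A (H.tgt e) = b₄
    cases b₁ <;> cases b₂ <;> cases b₃ <;> cases b₄ <;> simp <;> omega

lemma wdeg_ite [DecidableEq EK] (y : EK → ℕ) (c : ℕ) (q : VK) :
    K.wdeg (fun k => if k = f then c else y k) q + y f * (delta q (K.src f) + delta q (K.tgt f)) =
      K.wdeg y q + c * (delta q (K.src f) + delta q (K.tgt f)) := by
  have := sum_ite_eq_add f (fun k => c * (delta q (K.src k) + delta q (K.tgt k)))
    (fun k => y k * (delta q (K.src k) + delta q (K.tgt k)))
  rw [wdeg, wdeg, ← this]
  congr 1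
  exact Finset.sum_congr rfl fun k _ => by split_ifs <;> rfl

lemma le_wdeg_src (y : EK → ℕ) (f : EK) : y f ≤ K.wdeg y (K.src f) := by
  have := Finset.single_le_sum (f := fun k => y k * (delta (K.src f) (K.src k) +
    delta (K.src f) (K.tgt k))) (fun _ _ => Nat.zero_le _) (Finset.mem_univ f)
  simp only [delta_self] at this
  unfold wdeg
  nlinarith [Nat.zero_le (y f * delta (K.src f) (K.tgt f))]

lemma le_wdeg_tgt (y : EK → ℕ) (f : EK) : y f ≤ K.wdeg y (K.tgt f) := by
  have := Finset.single_le_sum (f := fun k => y k * (delta (K.tgt f) (K.src k) +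
    delta (K.tgt f) (K.tgt k))) (fun _ _ => Nat.zero_le _) (Finset.mem_univ f)
  simp only [delta_self] at this
  unfold wdeg
  nlinarith [Nat.zero_le (y f * delta (K.tgt f) (K.src f))]

-- Each identified vertex is matched either within `H` or within `K`. Since `K` has even order and
-- its other vertices are matched inside `K`, both identified vertices are matched on the same side;
-- the other side is completed by its deleted edge.
open Classical in
theorem PM.glue {r : ℕ} (hr : 0 < r) (hH : H.IsR r) (hK : K.IsR r) {x : EH ⊕ EK → ℕ}
    (hx : (glue H K e f).PM x) :
    ∃ z ≤ 1, H.PM (fun a => if a = e then z else x (.inl a)) ∧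
      K.PM (fun k => if k = f then 1 - z else x (.inr k)) := by
  have hne := hK.ne f
  set X := K.wdeg (fun k => x (.inr k)) (K.src f) with hX
  set Y := K.wdeg (fun k => x (.inr k)) (K.tgt f) with hY
  have hXf : x (.inr f) ≤ X := le_wdeg_src (fun k => x (.inr k)) f
  have hYf : x (.inr f) ≤ Y := le_wdeg_tgt (fun k => x (.inr k)) f
  have hu : 1 + (x (.inl e) + x (.inr f)) = H.wdeg (fun a => x (.inl a)) (H.src e) + X := by
    have := glue_wdeg_inl (H := H) (e := e) hne x (H.src e)
    rw [hx, delta_self, delta_of_ne (hH.ne e).symm, ← hX] at this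
    simpa using this
  have hv : 1 + (x (.inl e) + x (.inr f)) = H.wdeg (fun a => x (.inl a)) (H.tgt e) + Y := by
    have := glue_wdeg_inl (H := H) (e := e) hne x (H.tgt e)
    rw [hx, delta_self, delta_of_ne (hH.ne e), ← hY] at this
    simpa using this
  have hue : x (.inl e) ≤ H.wdeg (fun a => x (.inl a)) (H.src e) :=
    le_wdeg_src (fun a => x (.inl a)) e
  have hve : x (.inl e) ≤ H.wdeg (fun a => x (.inl a)) (H.tgt e) :=
    le_wdeg_tgt (fun a => x (.inl a)) e
  have hin : ∀ q, q ≠ K.src f → q ≠ K.tgt f → K.wdeg (fun k => x (.inr k)) q = 1 :=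
    fun q h1 h2 => by rw [← glue_wdeg_inr (H := H) (e := e) hne x q h1 h2, hx]
  have hXY : X = Y := by
    have h1 := K.handshake (fun k => x (.inr k)) (fun _ => 1)
    have h2 : ∑ q, K.wdeg (fun k => x (.inr k)) q + 2 = Fintype.card VK + X + Y := by
      have hy : K.tgt f ∈ Finset.univ.erase (K.src f) := by simp [hne.symm]
      have hcard : Fintype.card VK = ∑ _q : VK, 1 := by simp
      rw [hcard, ← Finset.add_sum_erase _ _ (Finset.mem_univ (K.src f)),
        ← Finset.add_sum_erase _ _ hy,
        ← Finset.add_sum_erase (a := K.src f) _ (fun _ => 1) (Finset.mem_univ _),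
        ← Finset.add_sum_erase _ (fun _ => 1) hy]
      have : ∑ v ∈ (Finset.univ.erase (K.src f)).erase (K.tgt f), K.wdeg (fun k => x (.inr k)) v
          = ∑ v ∈ (Finset.univ.erase (K.src f)).erase (K.tgt f), 1 :=
        Finset.sum_congr rfl fun v hv => by
          simp only [Finset.mem_erase] at hv
          exact hin v hv.2.1 hv.1
      rw [this]
      ring
    obtain ⟨c, hc⟩ := hK.even_card hr
    simp only [one_mul, ← Finset.sum_mul] at h1
    omega
  -- `z` counts the matching edges at an identified vertex that come from `K` and differ from `f`.
  -- If there is one, `H` lacks an edge there and needs `e`.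
  obtain ⟨z, hz⟩ : ∃ z, X = x (.inr f) + z := ⟨X - x (.inr f), by omega⟩
  have hz1 : z ≤ 1 := by omega
  refine ⟨z, hz1, fun p => ?_, fun q => ?_⟩
  · have h1 := wdeg_ite (K := H) (f := e) (fun a => x (.inl a)) z p
    have h2 := glue_wdeg_inl (H := H) (e := e) hne x p
    rw [hx, ← hX, ← hY, ← hXY, hz] at h2
    nlinarith
  · have h1 := wdeg_ite (K := K) (f := f) (fun k => x (.inr k)) (1 - z) q
    by_cases hq1 : q = K.src f
    · subst hq1
      rw [delta_self, delta_of_ne hne.symm, ← hX] at h1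
      omega
    by_cases hq2 : q = K.tgt f
    · subst hq2
      rw [delta_self, delta_of_ne hne, ← hY] at h1
      omega
    rw [delta_of_ne (Ne.symm hq1), delta_of_ne (Ne.symm hq2), hin q hq1 hq2] at h1
    simpa using h1

end glue

/-! ### The thickened Petersen graph -/

/-- The Petersen graph, with two of its perfect matchings taken `a` and `b` more times. -/
def petersen (a b : ℕ) : WGraph (Fin 10) (Fin 15) where
  src := ![0, 1, 2, 3, 4, 0, 1, 2, 3, 4, 5, 6, 7, 8, 9]
  tgt := ![1, 2, 3, 4, 0, 5, 6, 7, 8, 9, 7, 8, 9, 5, 6]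
  mult := ![1 + b, 1, 1 + b, 1, 1, 1 + a, 1 + a, 1 + a, 1 + a, 1 + a + b, 1 + b, 1 + b, 1, 1, 1]

lemma petersen_wdeg (a b : ℕ) (y : Fin 15 → ℕ) (v : Fin 10) :
    (petersen a b).wdeg y v = ![y 0 + y 4 + y 5, y 0 + y 1 + y 6, y 1 + y 2 + y 7,
      y 2 + y 3 + y 8, y 3 + y 4 + y 9, y 5 + y 10 + y 13, y 6 + y 11 + y 14,
      y 7 + y 10 + y 12, y 8 + y 11 + y 13, y 9 + y 12 + y 14] v := by
  fin_cases v <;>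
  simp [wdeg, Fin.sum_univ_succ, petersen, delta] <;> ring_nf

/-- The boundary of an odd set splits into a Petersen cut, of size at least 3, and the two thickened
perfect matchings, each of which meets every odd cut. -/
lemma petersen_cut : ∀ b0 b1 b2 b3 b4 b5 b6 b7 b8 b9 : Bool,
    (b0.toNat + b1.toNat + b2.toNat + b3.toNat + b4.toNat + b5.toNat + b6.toNat + b7.toNat +
      b8.toNat + b9.toNat) % 2 = 1 →
    1 ≤ (b0 ^^ b5).toNat + (b1 ^^ b6).toNat + (b2 ^^ b7).toNat + (b3 ^^ b8).toNat +
      (b4 ^^ b9).toNat ∧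
    1 ≤ (b0 ^^ b1).toNat + (b2 ^^ b3).toNat + (b4 ^^ b9).toNat + (b5 ^^ b7).toNat +
      (b6 ^^ b8).toNat ∧
    3 ≤ (b0 ^^ b1).toNat + (b1 ^^ b2).toNat + (b2 ^^ b3).toNat + (b3 ^^ b4).toNat +
      (b4 ^^ b0).toNat + (b0 ^^ b5).toNat + (b1 ^^ b6).toNat + (b2 ^^ b7).toNat +
      (b3 ^^ b8).toNat + (b4 ^^ b9).toNat + (b5 ^^ b7).toNat + (b6 ^^ b8).toNat +
      (b7 ^^ b9).toNat + (b8 ^^ b5).toNat + (b9 ^^ b6).toNat := by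
  decide +kernel

lemma petersen_isR (a b : ℕ) : (petersen a b).IsR (a + b + 3) where
  ne := by intro e; fin_cases e <;> simp [petersen]
  deg := by
    intro v
    rw [petersen_wdeg]
    fin_cases v <;> simp [petersen] <;> ring
  le_cut := by
    intro S hS
    have h1 := petersen_cut (S 0) (S 1) (S 2) (S 3) (S 4) (S 5) (S 6) (S 7) (S 8) (S 9)
      (by
        rw [Nat.odd_iff] at hS
        rw [← hS]
        simp only [size, Fin.sum_univ_succ]
        simp [add_assoc])
    obtain ⟨h1, h2, h3⟩ := h1
    have h4 := Nat.mul_le_mul_left a h1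
    have h5 := Nat.mul_le_mul_left b h2
    simp [cut, Fin.sum_univ_succ, petersen]
    linarith

/-- If `2 * s - 1` is a lower bound for the edges of multiplicity `s < a + 2` among those disjoint
from the edge `0`, then the edge `0` is used at most `2 * (1 + b)` times. -/
lemma petersen_sum_zero_le {a b : ℕ} {x : Fin (2 * (a + b + 3) - 1) → Fin 15 → ℕ}
    (hx : ∀ i, (petersen a b).PM (x i))
    (hs : ∀ k ≠ 0, (petersen a b).mult k ≤ a + 1 → 2 * (petersen a b).mult k ≤ ∑ i, x i k + 1) :
    ∑ i, x i 0 ≤ 2 * (b + 1) := by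
  have h5 := hs 5 (by decide) (by simp [petersen]; omega)
  have h6 := hs 6 (by decide) (by simp [petersen]; omega)
  have h8 := hs 8 (by decide) (by simp [petersen]; omega)
  have h1 := hs 1 (by decide) (by simp [petersen])
  have h4 := hs 4 (by decide) (by simp [petersen])
  have h12 := hs 12 (by decide) (by simp [petersen])
  simp [petersen] at h1 h4 h5 h6 h8 h12
  -- The vertices 2, 4, 5, 6 are independent, and the other six vertices induce only the edges 0, 8,
  -- 12; hence a perfect matching has exactly one of these three. Adding the degree equations at 0
  -- and 1, the ends of edge 0, gives the first identity.
  have key : ∀ i, (x i 1 + x i 4 + x i 12) + (x i 5 + x i 6 + x i 8) + 3 * x i 0 = 3 ∧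
      ∃ c, x i 1 + x i 4 + x i 12 = 2 * c := by
    intro i
    have h := fun v => (petersen_wdeg a b (x i) v).symm.trans (hx i v)
    have e0 := h 0
    have e1 := h 1
    have e2 := h 2
    have e3 := h 3
    have e4 := h 4
    have e5 := h 5
    have e6 := h 6
    have e7 := h 7
    have e8 := h 8
    have e9 := h 9
    simp at e0 e1 e2 e3 e4 e5 e6 e7 e8 e9
    constructor
    · omega
    · refine ⟨(x i 1 + x i 4 + x i 12) / 2, ?_⟩
      clear h1 h4 h5 h6 h8 h12 h
      rcases Nat.le_one_iff_eq_zero_or_eq_one.1 ((hx i).le_one 1) with h1 | h1 <;>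
      rcases Nat.le_one_iff_eq_zero_or_eq_one.1 ((hx i).le_one 4) with h4 | h4 <;>
      rcases Nat.le_one_iff_eq_zero_or_eq_one.1 ((hx i).le_one 12) with h12 | h12 <;>
      rcases Nat.le_one_iff_eq_zero_or_eq_one.1 ((hx i).le_one 14) with h14 | h14 <;>
      omega
  choose hk c hc using key
  have h2 := Finset.sum_congr (rfl : (Finset.univ : Finset (Fin (2 * (a + b + 3) - 1))) = _)
    fun i _ => hk i
  have h3 := Finset.sum_congr (rfl : (Finset.univ : Finset (Fin (2 * (a + b + 3) - 1))) = _)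
    fun i _ => hc i
  simp only [Finset.sum_add_distrib, ← Finset.mul_sum, Finset.sum_const, Finset.card_univ,
    Fintype.card_fin, smul_eq_mul] at h2 h3
  -- The edges 1, 4, 12 are used at least 3 times in total, hence at least 4 times by parity; 5, 6,
  -- 8 at least `6a + 3` times. So three times the use of edge 0 is at most `6b + 8`. Without parity
  -- the bound would be `6b + 9`, which is one use too many.
  omega

/-! ### Raising the multiplicity in bundle covers -/

/-- Every weighted `r`-graph has `2 * r - 1` perfect matchings such that every edge of multiplicity
`m ≤ s` is in at least `2 * m - 1` of them. -/
def HasBundleCovers (r s : ℕ) : Prop :=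
  ∀ (V E : Type) [Fintype V] [Fintype E] (G : WGraph V E), G.IsR r →
    ∃ x : Fin (2 * r - 1) → E → ℕ, (∀ i, G.PM (x i)) ∧
      ∀ e, G.mult e ≤ s → 2 * G.mult e ≤ ∑ i, x i e + 1

/-- The edges of multiplicity `s + 1` are treated one at a time. Gluing a Petersen graph at `e`
takes `e` out of `B`; although `e` survives in the separate component with its multiplicity, nothing
is claimed about it there. -/
lemma HasBundleCovers.aux {r s : ℕ} (hs : 1 ≤ s) (hsr : s + 1 < r) (h : HasBundleCovers r s)
    (n : ℕ) : ∀ (V E : Type) [Fintype V] [Fintype E] (G : WGraph V E), G.IsR r → ∀ B : Finset E,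
    B.card = n → (∀ e ∈ B, G.mult e = s + 1) →
    ∃ x : Fin (2 * r - 1) → E → ℕ, (∀ i, G.PM (x i)) ∧
      ∀ e, (G.mult e ≤ s ∨ e ∈ B) → 2 * G.mult e ≤ ∑ i, x i e + 1 := by
  classical
  induction n with
  | zero =>
    intro V E _ _ G hG B hB _
    obtain ⟨x, hx, hx'⟩ := h V E G hG
    rw [Finset.card_eq_zero] at hB
    subst hB
    exact ⟨x, hx, fun e he => hx' e (by simpa using he)⟩
  | succ n ih =>
    intro V E _ _ G hG B hB hBs
    obtain ⟨e, he⟩ : B.Nonempty := by rw [← Finset.card_pos]; omega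
    -- Chosen so that `e`, of multiplicity `a + 2`, and the Petersen edge 0, of multiplicity `b +
    -- 1`, add up to `r`, while the bundles of size `a + 1` still have size `s`.
    obtain ⟨a, b, hr, hsa⟩ : ∃ a b, r = a + b + 3 ∧ s = a + 1 :=
      ⟨s - 1, r - s - 2, by omega, by omega⟩
    subst hr
    have hP := petersen_isR a b
    obtain ⟨x, hx, hx'⟩ := ih _ _ (glue G (petersen a b) e 0)
      (hG.glue hP (by rw [hBs e he, hsa]; simp [petersen]; ring))
      ((B.erase e).map ⟨Sum.inl, Sum.inl_injective⟩)
      (by rw [Finset.card_map, Finset.card_erase_of_mem he]; omega)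
      (by
        intro k hk
        simp only [Finset.mem_map, Finset.mem_erase, Function.Embedding.coeFn_mk] at hk
        obtain ⟨a, ⟨-, ha⟩, rfl⟩ := hk
        exact hBs a ha)
    choose z hz1 hzG hzP using fun i => (hx i).glue (by omega) hG hP
    refine ⟨fun i a => if a = e then z i else x i (.inl a), hzG, fun k hk => ?_⟩
    by_cases hke : k = e
    · subst hke
      -- Edge 0 lies in a Petersen matching exactly when `e` is not in its partner, so `e` is used
      -- at least `(2r - 1) - 2(b + 1) = 2(s + 1) - 1` times.
      have h1 := petersen_sum_zero_le hzP (fun k hk0 hk => by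
        simp only [if_neg hk0]
        exact hx' (.inr k) (Or.inl (hsa ▸ hk)))
      simp only [if_true] at h1 ⊢
      have h2 : ∑ i, (1 - z i) + ∑ i, z i = 2 * (a + b + 3) - 1 := by
        rw [← Finset.sum_add_distrib, Finset.sum_congr rfl fun i _ => Nat.sub_add_cancel (hz1 i)]
        simp
      rw [hBs k he]
      omega
    · simp only [if_neg hke]
      refine hx' (.inl k) ?_
      rcases hk with hk | hk
      · exact Or.inl hk
      · exact Or.inr (by simp [hke, hk])

lemma HasBundleCovers.succ {r s : ℕ} (hs : 1 ≤ s) (hsr : s + 1 < r) (h : HasBundleCovers r s) :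
    HasBundleCovers r (s + 1) := by
  classical
  intro V E _ _ G hG
  obtain ⟨x, hx, hx'⟩ := h.aux hs hsr _ V E G hG (Finset.univ.filter fun e => G.mult e = s + 1) rfl
    (by simp)
  refine ⟨x, hx, fun e he => hx' e ?_⟩
  rcases Nat.le_succ_iff.1 he with h | h
  · exact Or.inl h
  · exact Or.inr (by simpa using h)

lemma HasBundleCovers.of_one {r s : ℕ} (h : HasBundleCovers r 1) (hs : 1 ≤ s) (hsr : s < r) :
    HasBundleCovers r s := by
  induction s, hs using Nat.le_induction with
  | base => exact h
  | succ s hs ih => exact (ih (by omega)).succ hs hsr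

/-! ### Translation between `Graph` and `WGraph` -/

/-- `W` is the graph `G`, up to a renaming of vertices and edges. -/
structure Represents {V E α β : Type} (W : WGraph V E) (G : Graph α β) (φ : V → α) (ε : E → β) :
    Prop where
  inj : φ.Injective
  range : Set.range φ = G.vertexSet
  inj_edge : ε.Injective
  range_edge : Set.range ε = G.edgeSet
  isLink : ∀ e, G.IsLink (ε e) (φ (W.src e)) (φ (W.tgt e))

namespace Represents

variable {V E α β : Type} {W : WGraph V E} {G : Graph α β} {φ : V → α} {ε : E → β}

lemma inc_iff (h : W.Represents G φ ε) (e : E) (v : V) :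
    G.Inc (ε e) (φ v) ↔ W.src e = v ∨ W.tgt e = v := by
  constructor
  · intro h'
    rcases h'.eq_or_eq_of_isLink (h.isLink e) with h1 | h1
    · exact .inl (h.inj h1).symm
    · exact .inr (h.inj h1).symm
  · rintro (rfl | rfl)
    · exact (h.isLink e).inc_left
    · exact (h.isLink e).inc_right

lemma ne_iff (h : W.Represents G φ ε) : (∀ e, W.src e ≠ W.tgt e) ↔ G.Loopless := by
  constructor
  · refine fun hne => ⟨fun b a hb => ?_⟩
    obtain ⟨e, rfl⟩ : b ∈ Set.range ε := h.range_edge ▸ hb.edge_mem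
    have h1 := hb.eq_of_inc (h.isLink e).inc_left
    have h2 := hb.eq_of_inc (h.isLink e).inc_right
    exact hne e (h.inj (h1.symm.trans h2))
  · intro hl e he
    have := h.isLink e
    rw [he] at this
    exact hl.not_isLoopAt _ _ this

variable [Fintype E]

lemma ncard_image (h : W.Represents G φ ε) (p : E → Prop) [DecidablePred p] :
    (ε '' {e | p e}).ncard = ∑ e, if p e then 1 else 0 := by
  rw [Set.ncard_image_of_injective _ h.inj_edge, Finset.sum_boole, Set.ncard_eq_toFinset_card']
  simp

lemma vertexDegree_eq (h : W.Represents G φ ε) (hne : ∀ e, W.src e ≠ W.tgt e) (v : V) :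
    G.vertexDegree (φ v) = W.wdeg (fun _ => 1) v := by
  classical
  have h1 : G.incidenceSet (φ v) = ε '' {e | W.src e = v ∨ W.tgt e = v} := by
    ext b
    constructor
    · intro hb
      obtain ⟨e, rfl⟩ : b ∈ Set.range ε := h.range_edge ▸ Graph.Inc.edge_mem hb
      exact ⟨e, (h.inc_iff e v).1 hb, rfl⟩
    · rintro ⟨e, he, rfl⟩
      exact (h.inc_iff e v).2 he
  rw [Graph.vertexDegree, h1, h.ncard_image, wdeg]
  refine Finset.sum_congr rfl fun e _ => ?_
  by_cases h1 : W.src e = v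
  · subst h1; simp [delta_of_ne (hne e).symm]
  · by_cases h2 : W.tgt e = v
    · subst h2; simp [delta_of_ne h1]
    · simp [h1, h2, delta_of_ne h1, delta_of_ne h2]

lemma ncard_edgeBoundary (h : W.Represents G φ ε) (S : Set α) (T : V → Bool)
    (hT : ∀ v, T v = true ↔ φ v ∈ S) :
    (G.edgeBoundary S).ncard = W.cut (fun _ => 1) T := by
  classical
  have h1 : G.edgeBoundary S = ε '' {e | T (W.src e) ≠ T (W.tgt e)} := by
    ext b
    constructor
    · rintro ⟨x, y, hb, hx, hy⟩
      obtain ⟨e, rfl⟩ : b ∈ Set.range ε := h.range_edge ▸ hb.edge_mem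
      refine ⟨e, fun hc => ?_, rfl⟩
      rw [Bool.eq_iff_iff, hT, hT] at hc
      rcases hb.eq_and_eq_or_eq_and_eq (h.isLink e) with ⟨rfl, rfl⟩ | ⟨rfl, rfl⟩ <;> tauto
    · rintro ⟨e, he, rfl⟩
      rw [Set.mem_ofPred_eq, Ne, Bool.eq_iff_iff, hT, hT] at he
      by_cases h2 : φ (W.src e) ∈ S
      · exact ⟨_, _, h.isLink e, h2, fun h3 => he ⟨fun _ => h3, fun _ => h2⟩⟩
      · exact ⟨_, _, (h.isLink e).symm, by tauto, h2⟩
  rw [h1, h.ncard_image, cut]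
  refine Finset.sum_congr rfl fun e _ => ?_
  cases T (W.src e) <;> cases T (W.tgt e) <;> simp

lemma size_eq [Fintype V] (h : W.Represents G φ ε) (S : Set α) (hS : S ⊆ G.vertexSet)
    (T : V → Bool) (hT : ∀ v, T v = true ↔ φ v ∈ S) : size T = S.ncard := by
  classical
  have h1 : S = φ '' {v | T v = true} := by
    ext a
    constructor
    · intro ha
      obtain ⟨v, rfl⟩ : a ∈ Set.range φ := h.range ▸ hS ha
      exact ⟨v, (hT v).2 ha, rfl⟩
    · rintro ⟨v, hv, rfl⟩
      exact (hT v).1 hv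
  rw [h1, Set.ncard_image_of_injective _ h.inj, Set.ncard_eq_toFinset_card', size]
  simp only [Set.toFinset_ofPred, Finset.card_filter]
  exact Finset.sum_congr rfl fun v _ => by cases T v <;> simp

lemma isR_iff [Fintype V] (h : W.Represents G φ ε) (hm : ∀ e, W.mult e = 1) (r : ℕ) :
    W.IsR r ↔ G.IsRGraph r := by
  classical
  have hm' : W.mult = fun _ => 1 := funext hm
  constructor
  · intro hW
    refine ⟨h.range ▸ Set.finite_range φ, h.range_edge ▸ Set.finite_range ε, h.ne_iff.1 hW.ne,
      fun a ha => ?_, fun S hS hodd => ?_⟩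
    · obtain ⟨v, rfl⟩ : a ∈ Set.range φ := h.range ▸ ha
      rw [h.vertexDegree_eq hW.ne, ← hm']
      exact hW.deg v
    · rw [h.ncard_edgeBoundary S (fun v => decide (φ v ∈ S)) (by simp), ← hm']
      exact hW.le_cut _ (by rwa [h.size_eq S hS _ (by simp)])
  · intro hG
    have hne := h.ne_iff.2 hG.loopless
    refine ⟨hne, fun v => ?_, fun T hT => ?_⟩
    · rw [hm']
      exact (h.vertexDegree_eq hne v).symm.trans (hG.regular _ (h.range ▸ Set.mem_range_self v))
    · have hT' : ∀ v, T v = true ↔ φ v ∈ φ '' {v | T v = true} := fun v => by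
        simp [h.inj.eq_iff]
      have hS : φ '' {v | T v = true} ⊆ G.vertexSet := by
        rintro _ ⟨v, -, rfl⟩
        exact h.range ▸ Set.mem_range_self v
      have := hG.le_edgeBoundary _ hS (by rwa [← h.size_eq _ hS T hT'])
      rwa [h.ncard_edgeBoundary _ T hT', ← hm'] at this

open Classical in
lemma pm_of_isPerfectMatching (h : W.Represents G φ ε) (hne : ∀ e, W.src e ≠ W.tgt e)
    {M : Set β} (hM : G.IsPerfectMatching M) : W.PM fun e => if ε e ∈ M then 1 else 0 := by
  intro v
  obtain ⟨b, ⟨hbM, hbv⟩, huniq⟩ := hM.2 (φ v) (h.range ▸ Set.mem_range_self v)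
  obtain ⟨e, rfl⟩ : b ∈ Set.range ε := h.range_edge ▸ hbv.edge_mem
  rw [h.inc_iff] at hbv
  rw [wdeg, Finset.sum_eq_single e]
  · rcases hbv with rfl | rfl
    · simp [hbM, delta_of_ne (hne e).symm]
    · simp [hbM, delta_of_ne (hne e)]
  · intro k _ hk
    by_cases hkM : ε k ∈ M
    · have : ¬ (W.src k = v ∨ W.tgt k = v) := fun hc =>
        hk (h.inj_edge (huniq _ ⟨hkM, (h.inc_iff k v).2 hc⟩))
      push Not at this
      simp [delta_of_ne this.1, delta_of_ne this.2]
    · simp [hkM]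
  · simp

lemma isPerfectMatching_of_pm (h : W.Represents G φ ε) {x : E → ℕ} (hx : W.PM x) :
    G.IsPerfectMatching (ε '' {e | x e = 1}) := by
  refine ⟨?_, fun a ha => ?_⟩
  · rintro _ ⟨e, -, rfl⟩
    exact h.range_edge ▸ Set.mem_range_self e
  · obtain ⟨v, rfl⟩ : a ∈ Set.range φ := h.range ▸ ha
    have hv := hx v
    have hnz : ∃ e ∈ Finset.univ, x e * (delta v (W.src e) + delta v (W.tgt e)) ≠ 0 :=
      Finset.exists_ne_zero_of_sum_ne_zero (by rw [wdeg] at hv; omega)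
    have hinc : ∀ e, delta v (W.src e) + delta v (W.tgt e) ≠ 0 ↔ W.src e = v ∨ W.tgt e = v := by
      intro e
      by_cases h1 : W.src e = v <;> by_cases h2 : W.tgt e = v <;>
        simp [h1, h2, delta_of_ne]
    obtain ⟨e, -, he⟩ := hnz
    have hone : ∀ e, x e ≠ 0 → x e = 1 := fun e he => by have := hx.le_one e; omega
    refine ⟨ε e, ⟨⟨e, hone e (left_ne_zero_of_mul he), rfl⟩,
      (h.inc_iff e v).2 ((hinc e).1 (right_ne_zero_of_mul he))⟩, ?_⟩
    rintro _ ⟨⟨k, hk, rfl⟩, hkv⟩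
    by_contra hne
    have hke : k ≠ e := fun hc => hne (by rw [hc])
    have h2 := (hinc k).2 ((h.inc_iff k v).1 hkv)
    classical
    have h3 := Finset.sum_le_sum_of_subset
      (f := fun e => x e * (delta v (W.src e) + delta v (W.tgt e))) (Finset.subset_univ {k, e})
    rw [Finset.sum_pair hke] at h3
    rw [wdeg] at hv
    have h4 : x k = 1 := hk
    rw [hv, h4] at h3
    omega

end Represents

/-- The weighted version of `Graph.HasBergeCover`. -/
def HasBerge {V E : Type} [Fintype E] (W : WGraph V E) (r : ℕ) : Prop :=
  ∃ x : Fin (2 * r - 1) → E → ℕ, (∀ i, W.PM (x i)) ∧ ∀ e, 1 ≤ ∑ i, x i e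

namespace Represents

variable {V E α β : Type} [Fintype E] {W : WGraph V E} {G : Graph α β} {φ : V → α} {ε : E → β}

lemma hasBerge_iff (h : W.Represents G φ ε) (hne : ∀ e, W.src e ≠ W.tgt e) (r : ℕ) :
    W.HasBerge r ↔ G.HasBergeCover r := by
  classical
  constructor
  · rintro ⟨x, hx, hc⟩
    refine ⟨fun i => ε '' {e | x i e = 1}, fun i => h.isPerfectMatching_of_pm (hx i), ?_⟩
    intro b hb
    obtain ⟨e, rfl⟩ : b ∈ Set.range ε := h.range_edge ▸ hb
    obtain ⟨i, -, hi⟩ := Finset.exists_ne_zero_of_sum_ne_zero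
      (show ∑ i, x i e ≠ 0 by have := hc e; omega)
    have := (hx i).le_one e
    exact ⟨i, e, show x i e = 1 by omega, rfl⟩
  · rintro ⟨M, hM, hc⟩
    refine ⟨fun i e => if ε e ∈ M i then 1 else 0, fun i => h.pm_of_isPerfectMatching hne (hM i),
      fun e => ?_⟩
    obtain ⟨i, hi⟩ := hc (ε e) (h.range_edge ▸ Set.mem_range_self e)
    have := Finset.single_le_sum (f := fun i => if ε e ∈ M i then 1 else 0)
      (fun _ _ => Nat.zero_le _) (Finset.mem_univ i)
    simpa [hi] using this

lemma hasFulkersonCover (h : W.Represents G φ ε) {r : ℕ} (x : Fin (2 * r) → E → ℕ)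
    (hx : ∀ i, W.PM (x i)) (hc : ∀ e, ∑ i, x i e = 2) : G.HasFulkersonCover r := by
  classical
  refine ⟨fun i => ε '' {e | x i e = 1}, fun i => h.isPerfectMatching_of_pm (hx i), ?_⟩
  intro b hb
  obtain ⟨e, rfl⟩ : b ∈ Set.range ε := h.range_edge ▸ hb
  refine Eq.trans ?_ (hc e)
  rw [Set.ncard_eq_toFinset_card']
  simp only [Set.mem_image, Set.mem_ofPred_eq, h.inj_edge.eq_iff, exists_eq_right,
    Set.toFinset_ofPred, Finset.card_filter]
  refine Finset.sum_congr rfl fun i _ => ?_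
  have := (hx i).le_one e
  split_ifs <;> omega

end Represents

section ofGraph

variable {α β : Type}

/-- A graph as a `WGraph` with an arbitrary orientation. -/
noncomputable def ofGraph (G : Graph α β) : WGraph G.vertexSet G.edgeSet where
  src e := ⟨_, (Graph.exists_isLink_of_mem_edgeSet e.2).choose_spec.choose_spec.left_mem⟩
  tgt e := ⟨_, (Graph.exists_isLink_of_mem_edgeSet e.2).choose_spec.choose_spec.right_mem⟩
  mult _ := 1

lemma ofGraph_represents (G : Graph α β) :
    (ofGraph G).Represents G Subtype.val Subtype.val where
  inj := Subtype.val_injective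
  range := Subtype.range_coe
  inj_edge := Subtype.val_injective
  range_edge := Subtype.range_coe
  isLink e := (Graph.exists_isLink_of_mem_edgeSet e.2).choose_spec.choose_spec

/-- The underlying `Graph` of a `WGraph`; multiplicities are ignored. -/
def toGraph {V E : Type} (W : WGraph V E) : Graph V E where
  vertexSet := Set.univ
  IsLink e x y := (W.src e = x ∧ W.tgt e = y) ∨ (W.src e = y ∧ W.tgt e = x)
  isLink_symm e _ := ⟨fun _ _ h => h.symm⟩
  eq_or_eq_of_isLink_of_isLink := by
    rintro e x y v w (⟨rfl, rfl⟩ | ⟨rfl, rfl⟩) (⟨rfl, rfl⟩ | ⟨rfl, rfl⟩) <;> simp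
  left_mem_of_isLink _ _ _ _ := Set.mem_univ _

lemma toGraph_isLink {V E : Type} (W : WGraph V E) (e : E) (x y : V) :
    W.toGraph.IsLink e x y ↔
      (W.src e = x ∧ W.tgt e = y) ∨ (W.src e = y ∧ W.tgt e = x) := Iff.rfl

lemma toGraph_represents {V E : Type} (W : WGraph V E) : W.Represents W.toGraph id id where
  inj := Function.injective_id
  range := by simp [toGraph]
  inj_edge := Function.injective_id
  range_edge := by
    ext e
    simp [Graph.edge_mem_iff_exists_isLink, toGraph_isLink]
    exact ⟨_, _, .inl ⟨rfl, rfl⟩⟩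
  isLink e := .inl ⟨rfl, rfl⟩

end ofGraph

section expand

variable {V E : Type} [Fintype E]

/-- Replace every edge by as many parallel edges as its multiplicity says. -/
def expand (W : WGraph V E) : WGraph V (Σ e, Fin (W.mult e)) where
  src p := W.src p.1
  tgt p := W.tgt p.1
  mult _ := 1

lemma expand_wdeg (W : WGraph V E) (x : (Σ e, Fin (W.mult e)) → ℕ) (v : V) :
    W.expand.wdeg x v = W.wdeg (fun e => ∑ j, x ⟨e, j⟩) v := by
  simp [wdeg, expand, Fintype.sum_sigma, Finset.sum_mul]

lemma expand_isR [Fintype V] {W : WGraph V E} {r : ℕ} (hW : W.IsR r) : W.expand.IsR r where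
  ne p := hW.ne p.1
  deg v := by
    rw [expand_wdeg, ← hW.deg v]
    simp [expand]
  le_cut S hS := by
    refine (hW.le_cut S hS).trans (le_of_eq ?_)
    simp [cut, expand, Fintype.sum_sigma]

end expand

/-- The generalized Berge conjecture gives `HasBundleCovers` for edges of multiplicity one. -/
lemma hasBundleCovers_one {r : ℕ}
    (h : ∀ (α β : Type) (G : Graph α β), G.IsRGraph r → G.HasBergeCover r) :
    HasBundleCovers r 1 := by
  intro V E _ _ W hW
  have hR := expand_isR hW
  have h1 := W.expand.toGraph_represents
  obtain ⟨x, hx, hc⟩ := (h1.hasBerge_iff hR.ne r).2 (h _ _ _ ((h1.isR_iff (fun _ => rfl) r).1 hR))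
  refine ⟨fun i e => ∑ j, x i ⟨e, j⟩, fun i v => ?_, fun e he => ?_⟩
  · rw [← expand_wdeg, hx i v]
  · rcases Nat.le_one_iff_eq_zero_or_eq_one.1 he with h0 | h0
    · omega
    · have h2 := hc ⟨e, ⟨0, by omega⟩⟩
      have h3 : ∑ i, x i ⟨e, ⟨0, by omega⟩⟩ ≤ ∑ i, ∑ j, x i ⟨e, j⟩ :=
        Finset.sum_le_sum fun i _ => Finset.single_le_sum (f := fun j => x i ⟨e, j⟩)
          (fun _ _ => Nat.zero_le _) (Finset.mem_univ _)
      change 2 * W.mult e ≤ ∑ i, ∑ j, x i ⟨e, j⟩ + 1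
      omega

section reindex

variable {V E E' : Type}

/-- Rename the edges. -/
def reindex (W : WGraph V E) (σ : E' ≃ E) : WGraph V E' where
  src e := W.src (σ e)
  tgt e := W.tgt (σ e)
  mult e := W.mult (σ e)

variable [Fintype E] [Fintype E'] {W : WGraph V E} {σ : E' ≃ E}

lemma reindex_wdeg (x : E → ℕ) (v : V) :
    (W.reindex σ).wdeg (fun e => x (σ e)) v = W.wdeg x v :=
  Equiv.sum_comp σ fun e => x e * (delta v (W.src e) + delta v (W.tgt e))

lemma IsR.reindex [Fintype V] {r : ℕ} (h : W.IsR r) : (W.reindex σ).IsR r where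
  ne e := h.ne (σ e)
  deg v := (reindex_wdeg W.mult v).trans (h.deg v)
  le_cut S hS := (h.le_cut S hS).trans (le_of_eq (Equiv.sum_comp σ fun e =>
    W.mult e * (S (W.src e) ^^ S (W.tgt e)).toNat).symm)

lemma PM.of_reindex {x : E' → ℕ} (h : (W.reindex σ).PM x) : W.PM fun e => x (σ.symm e) := by
  intro v
  rw [← reindex_wdeg (σ := σ), ← h v]
  simp

end reindex

/-! ### From bundle covers to Fulkerson covers -/

/-- Two vertices joined by edges `false` and `true` of multiplicities `c` and `d`. -/
def dipole (c d : ℕ) : WGraph Bool Bool where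
  src _ := false
  tgt _ := true
  mult b := if b then d else c

lemma dipole_isR (c d : ℕ) : (dipole c d).IsR (c + d) where
  ne := by simp [dipole]
  deg := by
    intro v
    cases v <;> simp [wdeg, dipole, delta, add_comm]
  le_cut S hS := by
    revert hS
    simp only [size, cut, dipole, Fintype.sum_bool]
    cases S false <;> cases S true <;> simp [add_comm]

/-- The missing multiplicities `2 - ∑ i, x i e` have degree `2r - N = 1` at every vertex, so they
form the last perfect matching. -/
lemma exists_pm_family_of_le_two {V E : Type} [Fintype E] {W : WGraph V E} {N : ℕ}
    {r : ℕ} (hr : W.wdeg (fun _ => 1) = fun _ => r)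
    (hNr : N + 1 = 2 * r)
    (x : Fin N → E → ℕ) (hx : ∀ i, W.PM (x i)) (hc : ∀ e, ∑ i, x i e ≤ 2) :
    ∃ x : Fin (N + 1) → E → ℕ, (∀ i, W.PM (x i)) ∧ ∀ e, ∑ i, x i e = 2 := by
  refine ⟨Fin.cons (fun e => 2 - ∑ i, x i e) x, fun i => ?_, fun e => ?_⟩
  · refine Fin.cases (fun v => ?_) hx i
    rw [Fin.cons_zero]
    have h1 : W.wdeg (fun e => 2 - ∑ i, x i e) v + ∑ i, W.wdeg (x i) v
        = 2 * W.wdeg (fun _ => 1) v := by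
      simp only [wdeg]
      rw [Finset.sum_comm, ← Finset.sum_add_distrib, Finset.mul_sum]
      refine Finset.sum_congr rfl fun e _ => ?_
      rw [← Finset.sum_mul, ← add_mul, Nat.sub_add_cancel (hc e), one_mul]
    simp only [hx _ v, hr] at h1
    simp at h1
    omega
  · rw [Fin.sum_univ_succ]
    simp only [Fin.cons_zero, Fin.cons_succ]
    exact Nat.sub_add_cancel (hc e)

/-- Substituting `dipole 1 (r - 1)` for every edge creates a bundle of size `r - 1` that a perfect
matching uses exactly when it avoids the original edge. -/
lemma HasBundleCovers.fulkerson {V E : Type} [Fintype V] [Fintype E] {W : WGraph V E} {r : ℕ}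
    (hr : 3 ≤ r) (h : HasBundleCovers r (r - 1)) (hW : W.IsR r) (hm : ∀ e, W.mult e = 1) :
    ∃ x : Fin (2 * r) → E → ℕ, (∀ i, W.PM (x i)) ∧ ∀ e, ∑ i, x i e = 2 := by
  set σ : Empty ⊕ E ≃ E := Equiv.emptySum Empty E
  have hD : (dipole 1 (r - 1)).IsR r := by
    have := dipole_isR 1 (r - 1)
    rwa [show 1 + (r - 1) = r by omega] at this
  obtain ⟨x, hx, hc⟩ := h _ _ (subst (W.reindex σ) (fun _ : E => dipole 1 (r - 1))
    fun _ => false) (hW.reindex.subst (by omega) (fun _ => hD) (fun _ => hm _) (fun _ => rfl))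
  have hxW : ∀ i, W.PM fun e => x i (.inl (.inr e)) := fun i =>
    ((hx i).subst_base (by omega) (fun _ => hD)).of_reindex
  rw [show 2 * r = 2 * r - 1 + 1 by omega]
  refine exists_pm_family_of_le_two (r := r) (funext fun v => ?_) (by omega) _ hxW
    fun e => ?_
  · rw [← hW.deg v, (funext hm : W.mult = fun _ => 1)]
  · have h1 := hc (.inr ⟨e, true⟩) le_rfl
    have h2 : ∑ i, x i (.inl (.inr e)) + ∑ i, x i (.inr ⟨e, true⟩) = 2 * r - 1 := by
      rw [← Finset.sum_add_distrib]
      have : ∀ i, x i (.inl (.inr e)) + x i (.inr ⟨e, true⟩) = 1 := fun i => by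
        rw [(hx i).subst_eq (by omega) (fun _ => hD) e]
        have := (hx i).subst_gadget (by omega) (fun _ => hD) e true
        simp [wdeg, dipole, delta] at this
        omega
      simp [this]
    have h3 : (subst (W.reindex σ) (fun _ : E => dipole 1 (r - 1)) fun _ => false).mult
      (.inr ⟨e, true⟩) = r - 1 := rfl
    rw [h3] at h1
    omega

theorem hasFulkersonCover_of_berge {r : ℕ} (hr : 3 ≤ r)
    (h : ∀ (α β : Type) (G : Graph α β), G.IsRGraph r → G.HasBergeCover r)
    (α β : Type) (G : Graph α β) (hG : G.IsRGraph r) : G.HasFulkersonCover r := by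
  classical
  have := hG.finite_vertexSet.fintype
  have := hG.finite_edgeSet.fintype
  have hrep := ofGraph_represents G
  have hW := (hrep.isR_iff (fun _ => rfl) r).2 hG
  have hcov := (hasBundleCovers_one h).of_one (s := r - 1) (by omega) (by omega)
  obtain ⟨x, hx, hc⟩ := hcov.fulkerson hr hW (fun _ => rfl)
  exact hrep.hasFulkersonCover x hx hc

/-! ### Layered graphs -/

section layered

variable {V E : Type}

/-- The edges `e` and `e'` have the same ends. -/
def Parallel (W : WGraph V E) (e e' : E) : Prop :=
  (W.src e = W.src e' ∧ W.tgt e = W.tgt e') ∨ (W.src e = W.tgt e' ∧ W.tgt e = W.src e')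

/-- The edge `e` leads from `v` to the next higher level, or it is one of the special edges `Φ`. -/
def Up (W : WGraph V E) (h : V → ℕ) (Φ : E → Prop) (v : V) (e : E) : Prop :=
  (W.src e = v ∧ (Φ e ∨ h (W.tgt e) = h v + 1)) ∨ (W.tgt e = v ∧ (Φ e ∨ h (W.src e) = h v + 1))

/-- `W` has, apart from the edges in `Φ`, no parallel edges, all its edges join consecutive levels
or vertices of level `1`, and every vertex not in `Z` has exactly one upward edge. -/
structure Layered (W : WGraph V E) (h : V → ℕ) (Φ : E → Prop) (Z : V → Prop) : Prop where
  pos : ∀ v, 1 ≤ h v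
  level : ∀ e, ¬ Φ e → h (W.tgt e) = h (W.src e) + 1 ∨ h (W.src e) = h (W.tgt e) + 1 ∨
    (h (W.src e) = 1 ∧ h (W.tgt e) = 1)
  up : ∀ v, ¬ Z v → ∃! e, W.Up h Φ v e
  top : ∀ v, Z v → ∀ e, ¬ W.Up h Φ v e
  simple : ∀ e e', ¬ Φ e → ¬ Φ e' → W.Parallel e e' → e = e'

/-- Delete the edges `inr i`. -/
def keep {E₀ I : Type} (B : WGraph V (E₀ ⊕ I)) : WGraph V E₀ where
  src e := B.src (.inl e)
  tgt e := B.tgt (.inl e)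
  mult e := B.mult (.inl e)

variable {E₀ I : Type} {VK EK : I → Type} {B : WGraph V (E₀ ⊕ I)}
  {K : ∀ i, WGraph (VK i) (EK i)} {f : ∀ i, EK i} {h : V → ℕ} {Φ : E₀ → Prop} {Z : V → Prop}
  {hk : ∀ i, VK i → ℕ}

/-- In a piece the root serves as the upward edge of both its ends. Once it is removed, the two
connecting edges take over this role, since each end of the root lies one level below the base
vertex it is joined to. The substituted edges are not upward edges in `B.keep`, so the base vertices
keep theirs. -/
theorem Layered.subst (hB : B.keep.Layered h Φ Z)
    (hK : ∀ i, (K i).Layered (hk i) (· = f i) fun _ => False)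
    (hf : ∀ i, (K i).src (f i) ≠ (K i).tgt (f i))
    (hs : ∀ i, hk i ((K i).src (f i)) + 1 = h (B.tgt (.inr i)))
    (ht : ∀ i, hk i ((K i).tgt (f i)) + 1 = h (B.src (.inr i))) :
    (subst B K f).Layered (Sum.elim h fun p => hk p.1 p.2)
      (Sum.elim (Sum.elim Φ fun _ => False) fun _ => False) (Sum.elim Z fun _ => False) := by
  set h' : (V ⊕ Σ i, VK i) → ℕ := Sum.elim h fun p => hk p.1 p.2 with hh'
  set Φ' : (E₀ ⊕ I) ⊕ (Σ i, EK i) → Prop :=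
    Sum.elim (Sum.elim Φ fun _ => False) fun _ => False with hΦ'
  have u1 : ∀ v e, (WGraph.subst B K f).Up h' Φ' (.inl v) (.inl (.inl e)) ↔ B.keep.Up h Φ v e := by
    intro v e
    simp [Up, keep, hh', hΦ']
  have u2 : ∀ v i, ¬ (WGraph.subst B K f).Up h' Φ' (.inl v) (.inl (.inr i)) := by
    intro v i
    have := ht i
    simp only [Up, hh', hΦ', subst_src_inl, subst_tgt_inl_inr, Sum.elim_inl, Sum.elim_inr,
      false_or, Sum.inl.injEq, reduceCtorEq, false_and, or_false]
    rintro ⟨rfl, h1⟩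
    omega
  have u3 : ∀ v i k, ¬ (WGraph.subst B K f).Up h' Φ' (.inl v) (.inr ⟨i, k⟩) := by
    intro v i k
    have := hs i
    by_cases hkf : k = f i
    · subst hkf
      simp only [Up, hh', hΦ', subst_src_inr, subst_tgt_inr_self, Sum.elim_inl, Sum.elim_inr,
        false_or, Sum.inl.injEq, reduceCtorEq, false_and]
      rintro ⟨rfl, h1⟩
      omega
    · simp [Up, subst_tgt_inr_of_ne _ _ _ hkf]
  have u4 : ∀ i p e, ¬ (WGraph.subst B K f).Up h' Φ' (.inr ⟨i, p⟩) (.inl (.inl e)) := by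
    intro i p e
    simp [Up]
  have u5 : ∀ i p j, (WGraph.subst B K f).Up h' Φ' (.inr ⟨i, p⟩) (.inl (.inr j)) →
      j = i ∧ (K i).tgt (f i) = p := by
    intro i p j
    simp only [Up, subst_src_inl, subst_tgt_inl_inr, reduceCtorEq, false_and, false_or]
    rintro ⟨h1, -⟩
    cases h1
    exact ⟨rfl, rfl⟩
  have u5' : ∀ i, (WGraph.subst B K f).Up h' Φ' (.inr ⟨i, (K i).tgt (f i)⟩) (.inl (.inr i)) := by
    intro i
    refine .inr ⟨by simp, .inr ?_⟩
    simp [hh', ht]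
  have u6 : ∀ i p j k, (WGraph.subst B K f).Up h' Φ' (.inr ⟨i, p⟩) (.inr ⟨j, k⟩) →
      ∃ k', (⟨j, k⟩ : Σ i, EK i) = ⟨i, k'⟩ ∧ (K i).Up (hk i) (· = f i) p k' ∧
        (k' = f i → (K i).src (f i) = p) := by
    intro i p j k
    by_cases hkf : k = f j
    · subst hkf
      simp only [Up, subst_src_inr, subst_tgt_inr_self, reduceCtorEq, false_and, or_false]
      rintro ⟨h1, -⟩
      cases h1
      exact ⟨f _, rfl, .inl ⟨rfl, .inl rfl⟩, fun _ => rfl⟩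
    · simp only [Up, subst_src_inr, subst_tgt_inr_of_ne _ _ _ hkf]
      rintro (⟨h1, h2⟩ | ⟨h1, h2⟩)
      · cases h1
        exact ⟨k, rfl, .inl ⟨rfl, .inr (h2.resolve_left id)⟩, fun h => absurd h hkf⟩
      · cases h1
        exact ⟨k, rfl, .inr ⟨rfl, .inr (h2.resolve_left id)⟩, fun h => absurd h hkf⟩
  have u6' : ∀ i p k, k ≠ f i → (K i).Up (hk i) (· = f i) p k →
      (WGraph.subst B K f).Up h' Φ' (.inr ⟨i, p⟩) (.inr ⟨i, k⟩) := by
    intro i p k hkf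
    simp only [Up, subst_src_inr, subst_tgt_inr_of_ne _ _ _ hkf]
    rintro (⟨rfl, h2⟩ | ⟨rfl, h2⟩)
    · exact .inl ⟨rfl, .inr (h2.resolve_left hkf)⟩
    · exact .inr ⟨rfl, .inr (h2.resolve_left hkf)⟩
  have u6'' : ∀ i, (WGraph.subst B K f).Up h' Φ' (.inr ⟨i, (K i).src (f i)⟩) (.inr ⟨i, f i⟩) := by
    intro i
    refine .inl ⟨by simp, .inr ?_⟩
    simp [hh', hs]
  constructor
  · rintro (v | ⟨i, p⟩)
    · exact hB.pos v
    · exact (hK i).pos p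
  · rintro ((e | i) | ⟨i, k⟩) he
    · exact hB.level e he
    · right; left
      simp [hh', ht]
    · by_cases hkf : k = f i
      · subst hkf
        left
        simp [hh', hs]
      · rw [subst_tgt_inr_of_ne _ _ _ hkf]
        exact (hK i).level k hkf
  · rintro (v | ⟨i, p⟩) hv
    · obtain ⟨e, he, hu⟩ := hB.up v hv
      refine ⟨.inl (.inl e), (u1 v e).2 he, ?_⟩
      rintro ((e' | i) | ⟨i, k⟩) he'
      · rw [hu e' ((u1 v e').1 he')]
      · exact absurd he' (u2 v i)
      · exact absurd he' (u3 v i k)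
    · obtain ⟨k, hkU, hu⟩ := (hK i).up p id
      have hsp : (K i).src (f i) = p → k = f i := fun h => (hu _ (.inl ⟨h, .inl rfl⟩)).symm
      have htp : (K i).tgt (f i) = p → k = f i := fun h => (hu _ (.inr ⟨h, .inl rfl⟩)).symm
      by_cases hkf : k = f i
      · subst hkf
        rcases hkU with ⟨rfl, -⟩ | ⟨rfl, -⟩
        · refine ⟨.inr ⟨i, f i⟩, u6'' i, ?_⟩
          rintro ((e' | j) | ⟨j, k⟩) he'
          · exact absurd he' (u4 _ _ _)
          · exact absurd (u5 _ _ _ he').2.symm (hf i)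
          · obtain ⟨k', h1, h2, -⟩ := u6 _ _ _ _ he'
            rw [h1, hu k' h2]
        · refine ⟨.inl (.inr i), u5' i, ?_⟩
          rintro ((e' | j) | ⟨j, k⟩) he'
          · exact absurd he' (u4 _ _ _)
          · rw [(u5 _ _ _ he').1]
          · obtain ⟨k', h1, h2, h3⟩ := u6 _ _ _ _ he'
            exact absurd (h3 (hu k' h2)) (hf i)
      · refine ⟨.inr ⟨i, k⟩, u6' i p k hkf hkU, ?_⟩
        rintro ((e' | j) | ⟨j, k₁⟩) he'
        · exact absurd he' (u4 _ _ _)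
        · exact absurd (htp (u5 _ _ _ he').2) hkf
        · obtain ⟨k', h1, h2, -⟩ := u6 _ _ _ _ he'
          rw [h1, hu k' h2]
  · rintro (v | ⟨i, p⟩) hv
    · rintro ((e | i) | ⟨i, k⟩)
      · rw [u1]
        exact hB.top v hv e
      · exact u2 v i
      · exact u3 v i k
    · exact absurd hv id
  · have s1 : ∀ i k, k ≠ f i → ∀ j k', k' ≠ f j → (WGraph.subst B K f).Parallel (.inr ⟨i, k⟩)
        (.inr ⟨j, k'⟩) → (⟨i, k⟩ : Σ i, EK i) = ⟨j, k'⟩ := by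
      intro i k hk j k' hk' hp
      simp only [Parallel, subst_src_inr, subst_tgt_inr_of_ne _ _ _ hk,
        subst_tgt_inr_of_ne _ _ _ hk', Sum.inr.injEq] at hp
      have hij : i = j := by
        rcases hp with ⟨h1, -⟩ | ⟨h1, -⟩ <;> exact congrArg Sigma.fst h1
      subst hij
      simp only [Sigma.mk.injEq, heq_eq_eq, true_and] at hp
      rw [(hK i).simple k k' hk hk' hp]
    have s2 : ∀ i j, (WGraph.subst B K f).Parallel (.inl (.inr i)) (.inr ⟨j, f j⟩) → False := by
      intro i j hp
      simp only [Parallel, subst_src_inr, subst_src_inl, subst_tgt_inl_inr, subst_tgt_inr_self,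
        reduceCtorEq, false_and, false_or, Sum.inr.injEq] at hp
      have hij : i = j := congrArg Sigma.fst hp.2
      subst hij
      simp only [Sigma.mk.injEq, heq_eq_eq, true_and] at hp
      exact hf i hp.2.symm
    have symm : ∀ e e', (WGraph.subst B K f).Parallel e e' →
        (WGraph.subst B K f).Parallel e' e := by
      rintro e e' (⟨h1, h2⟩ | ⟨h1, h2⟩)
      · exact .inl ⟨h1.symm, h2.symm⟩
      · exact .inr ⟨h2.symm, h1.symm⟩
    rintro ((e | i) | ⟨i, k⟩) ((e' | j) | ⟨j, k'⟩) he he' hp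
    · have : B.keep.Parallel e e' := by simpa [Parallel, keep] using hp
      rw [hB.simple e e' he he' this]
    · simp [Parallel] at hp
    · simp [Parallel] at hp
    · simp [Parallel] at hp
    · simp only [Parallel, subst_src_inl, subst_tgt_inl_inr, reduceCtorEq, false_and, or_false,
        Sum.inr.injEq] at hp
      rw [show i = j from congrArg Sigma.fst hp.2]
    · by_cases hk' : k' = f j
      · subst hk'
        exact (s2 _ _ hp).elim
      · simp [Parallel, subst_tgt_inr_of_ne _ _ _ hk'] at hp
    · simp [Parallel] at hp
    · by_cases hk : k = f i
      · subst hk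
        exact (s2 _ _ (symm _ _ hp)).elim
      · simp [Parallel, subst_tgt_inr_of_ne _ _ _ hk] at hp
    · by_cases hk : k = f i <;> by_cases hk' : k' = f j
      · subst hk hk'
        simp only [Parallel, subst_src_inr, subst_tgt_inr_self, reduceCtorEq, false_and, or_false,
          Sum.inr.injEq] at hp
        rw [show i = j from congrArg Sigma.fst hp.1]
      · subst hk
        simp [Parallel, subst_tgt_inr_of_ne _ _ _ hk'] at hp
      · subst hk'
        simp [Parallel, subst_tgt_inr_of_ne _ _ _ hk] at hp
      · rw [s1 i k hk j k' hk' hp]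

end layered

/-! ### Gadgets -/

/-- An `r`-graph without multiplicities, layered with respect to a special edge whose ends have
levels `m` and `n`. -/
structure Gadget (r m n : ℕ) where
  V : Type
  E : Type
  fintypeV : Fintype V
  fintypeE : Fintype E
  graph : WGraph V E
  isR : graph.IsR r
  mult : ∀ e, graph.mult e = 1
  root : E
  height : V → ℕ
  layered : graph.Layered height (· = root) fun _ => False
  height_src : height (graph.src root) = m
  height_tgt : height (graph.tgt root) = n

attribute [instance] Gadget.fintypeV Gadget.fintypeE

section

variable {V E : Type}

/-- Reverse the orientation of all edges. -/
def rev (W : WGraph V E) : WGraph V E where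
  src := W.tgt
  tgt := W.src
  mult := W.mult

lemma IsR.rev [Fintype V] [Fintype E] {W : WGraph V E} {r : ℕ} (h : W.IsR r) : W.rev.IsR r where
  ne e := (h.ne e).symm
  deg v := by
    rw [← h.deg v]
    exact Finset.sum_congr rfl fun e _ => by simp only [WGraph.rev]; ring
  le_cut S hS := (h.le_cut S hS).trans (le_of_eq (Finset.sum_congr rfl fun e _ => by
    simp only [WGraph.rev, Bool.xor_comm]))

lemma rev_up {W : WGraph V E} {h : V → ℕ} {Φ : E → Prop} {v : V} {e : E} :
    W.rev.Up h Φ v e ↔ W.Up h Φ v e := Or.comm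

lemma Layered.rev {W : WGraph V E} {h : V → ℕ} {Φ : E → Prop} {Z : V → Prop}
    (hW : W.Layered h Φ Z) : W.rev.Layered h Φ Z where
  pos := hW.pos
  level e he := by have := hW.level e he; simp only [WGraph.rev]; tauto
  up v hv := by
    simpa only [rev_up] using hW.up v hv
  top v hv e := by
    simpa only [rev_up] using hW.top v hv e
  simple e e' he he' hp := hW.simple e e' he he' (by
    simp only [Parallel, WGraph.rev] at hp ⊢
    tauto)

end

/-- Exchange the ends of the special edge. -/
def Gadget.swap {r m n : ℕ} (g : Gadget r m n) : Gadget r n m where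
  __ := g
  graph := g.graph.rev
  isR := g.isR.rev
  layered := g.layered.rev
  height_src := g.height_tgt
  height_tgt := g.height_src

section subst

variable {r : ℕ} {V E₀ I : Type} [Fintype V] [Fintype E₀] [Fintype I] {B : WGraph V (E₀ ⊕ I)}
  {h : V → ℕ} {m n : I → ℕ}

/-- Replace all edges `inr i` by gadgets. -/
noncomputable def Gadget.subst (hr : 2 ≤ r) (hB : B.IsR r) (hm : ∀ e, B.mult e = 1) (e : E₀)
    (hl : B.keep.Layered h (· = e) fun _ => False) (g : ∀ i, Gadget r (m i) (n i))
    (hs : ∀ i, m i + 1 = h (B.tgt (.inr i))) (ht : ∀ i, n i + 1 = h (B.src (.inr i)))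
    {a b : ℕ} (ha : h (B.src (.inl e)) = a) (hb : h (B.tgt (.inl e)) = b) :
    Gadget r a b where
  V := V ⊕ Σ i, (g i).V
  E := (E₀ ⊕ I) ⊕ Σ i, (g i).E
  fintypeV := inferInstance
  fintypeE := inferInstance
  graph := WGraph.subst B (fun i => (g i).graph) fun i => (g i).root
  isR := hB.subst hr (fun i => (g i).isR) (fun i => hm _) fun i => (g i).mult _
  mult := by
    rintro (e | ⟨i, k⟩)
    · exact hm e
    · exact (g i).mult k
  root := .inl (.inl e)
  height := Sum.elim h fun p => (g p.1).height p.2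
  layered := by
    have := hl.subst (fun i => (g i).layered) (fun i => (g i).isR.ne _)
      (fun i => by rw [(g i).height_src, hs]) (fun i => by rw [(g i).height_tgt, ht])
    convert! this using 1
    · funext a
      rcases a with (a | a) | a <;> simp
    · funext a
      rcases a with a | a <;> simp
  height_src := ha
  height_tgt := hb

end subst

section completeBipartite

/-- The complete bipartite graph `K_{r,r}`. -/
def completeBipartite (r : ℕ) : WGraph (Bool × Fin r) (Fin r × Fin r) where
  src e := (false, e.1)
  tgt e := (true, e.2)
  mult _ := 1

lemma completeBipartite_isR (r : ℕ) : (completeBipartite r).IsR r where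
  ne := by simp [completeBipartite]
  deg := by
    rintro ⟨b, i⟩
    rw [wdeg, Fintype.sum_prod_type]
    cases b <;> simp [completeBipartite, delta]
  le_cut S hS := by
    have h1 : size S = ∑ i, (S (false, i)).toNat + ∑ i, (S (true, i)).toNat := by
      simp [size, Fintype.sum_prod_type, add_comm]
    have h2 : r * ∑ i, (S (false, i)).toNat ≤
        (completeBipartite r).cut (completeBipartite r).mult S + r * ∑ i, (S (true, i)).toNat := by
      have e1 : r * ∑ i, (S (false, i)).toNat = ∑ e : Fin r × Fin r, (S (false, e.1)).toNat := by
        simp [Fintype.sum_prod_type, Finset.mul_sum]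
      have e2 : r * ∑ i, (S (true, i)).toNat = ∑ e : Fin r × Fin r, (S (true, e.2)).toNat := by
        simp [Fintype.sum_prod_type]
      rw [e1, e2, cut, ← Finset.sum_add_distrib]
      refine Finset.sum_le_sum fun e _ => ?_
      simp only [completeBipartite]
      cases S (false, e.1) <;> cases S (true, e.2) <;> simp
    have h3 : r * ∑ i, (S (true, i)).toNat ≤
        (completeBipartite r).cut (completeBipartite r).mult S + r * ∑ i, (S (false, i)).toNat := by
      have e1 : r * ∑ i, (S (false, i)).toNat = ∑ e : Fin r × Fin r, (S (false, e.1)).toNat := by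
        simp [Fintype.sum_prod_type, Finset.mul_sum]
      have e2 : r * ∑ i, (S (true, i)).toNat = ∑ e : Fin r × Fin r, (S (true, e.2)).toNat := by
        simp [Fintype.sum_prod_type]
      rw [e1, e2, cut, ← Finset.sum_add_distrib]
      refine Finset.sum_le_sum fun e _ => ?_
      simp only [completeBipartite]
      cases S (false, e.1) <;> cases S (true, e.2) <;> simp
    rw [h1] at hS
    rcases lt_trichotomy (∑ i, (S (false, i)).toNat) (∑ i, (S (true, i)).toNat) with h | h | h
    · nlinarith
    · rw [h] at hS
      exact absurd hS (by simp)
    · nlinarith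

/-- The complete bipartite graph as a gadget. -/
def Gadget.base (r : ℕ) (hr : 1 ≤ r) : Gadget r 2 2 where
  V := Bool × Fin r
  E := Fin r × Fin r
  fintypeV := inferInstance
  fintypeE := inferInstance
  graph := completeBipartite r
  isR := completeBipartite_isR r
  mult _ := rfl
  root := (⟨0, hr⟩, ⟨0, hr⟩)
  -- Without the root edge, the two vertices on level 2 are joined exactly to the leaves of the
  -- opposite side; all other edges are horizontal on level 1.
  height v := if v.2 = ⟨0, hr⟩ then 2 else 1
  layered := by
    set z : Fin r := ⟨0, hr⟩
    constructor
    · intro v; split_ifs <;> omega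
    · rintro ⟨i, j⟩ h
      simp only [completeBipartite]
      by_cases hi : i = z <;> by_cases hj : j = z <;> simp [hi, hj]
      exact h (by rw [hi, hj])
    · rintro ⟨b, i⟩ -
      cases b
      · refine ⟨(i, z), ?_, ?_⟩
        · left
          by_cases hi : i = z <;> simp [completeBipartite, hi]
        · rintro ⟨i', j⟩ hu
          simp only [Up, completeBipartite, Prod.mk.injEq, true_and, reduceCtorEq, false_and,
            or_false] at hu
          obtain ⟨rfl, h1⟩ := hu
          by_cases hi : i' = z <;> by_cases hj : j = z <;> simp [hi, hj] at h1 ⊢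
      · refine ⟨(z, i), ?_, ?_⟩
        · right
          by_cases hi : i = z <;> simp [completeBipartite, hi]
        · rintro ⟨i', j⟩ hu
          simp only [Up, completeBipartite, Prod.mk.injEq, true_and, reduceCtorEq, false_and,
            false_or] at hu
          obtain ⟨rfl, h1⟩ := hu
          by_cases hi : i' = z <;> by_cases hj : j = z <;> simp [hi, hj] at h1 ⊢
    · exact fun _ h => h.elim
    · rintro ⟨i, j⟩ ⟨i', j'⟩ - - h
      simpa [Parallel, completeBipartite] using h
  height_src := by simp [completeBipartite]
  height_tgt := by simp [completeBipartite]

end completeBipartite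

section multiDipole

/-- Two vertices joined by `1 + k` edges. -/
def multiDipole (k : ℕ) : WGraph Bool (Unit ⊕ Fin k) where
  src _ := false
  tgt _ := true
  mult _ := 1

lemma multiDipole_isR (k : ℕ) : (multiDipole k).IsR (k + 1) where
  ne := by simp [multiDipole]
  deg := by
    intro v
    cases v <;> simp [wdeg, multiDipole, delta, add_comm]
  le_cut S hS := by
    revert hS
    simp only [size, cut, multiDipole, Fintype.sum_bool]
    cases S false <;> cases S true <;> simp [add_comm]

/-- Replace all but one edges of a dipole. -/
noncomputable def Gadget.succ {r n : ℕ} (hr : 2 ≤ r) (g : Gadget r n n) :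
    Gadget r (n + 1) (n + 1) :=
  Gadget.subst (B := multiDipole (r - 1)) (h := fun _ => n + 1) (m := fun _ => n) (n := fun _ => n)
    hr (by have := multiDipole_isR (r - 1); rwa [Nat.sub_add_cancel (by omega)] at this)
    (fun _ => rfl) ()
    { pos := fun _ => by omega
      level := fun e he => absurd rfl he
      up := fun v _ => ⟨(), by cases v <;> simp [Up, keep, multiDipole], fun _ _ => rfl⟩
      top := fun _ h => h.elim
      simple := fun _ _ _ _ _ => rfl }
    (fun _ => g) (fun _ => rfl) (fun _ => rfl) rfl rfl

end multiDipole

lemma nonempty_gadget {r : ℕ} (hr : 2 ≤ r) (n : ℕ) (hn : 2 ≤ n) : Nonempty (Gadget r n n) := by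
  induction n, hn using Nat.le_induction with
  | base => exact ⟨Gadget.base r (by omega)⟩
  | succ n _ ih => exact ih.map fun g => g.succ hr

section star

/-- A vertex joined to all vertices of a cycle of length `r`, whose edges are taken `k` times. -/
def wheel (r k : ℕ) : WGraph (Option (ZMod r)) (ZMod r ⊕ ZMod r × Fin k) where
  src := Sum.elim (fun _ => none) fun p => some p.1
  tgt := Sum.elim some fun p => some (p.1 + 1)
  mult _ := 1

lemma exists_boundary {r : ℕ} [NeZero r] (P : ZMod r → Prop) {i j : ZMod r} (hi : P i)
    (hj : ¬ P j) : ∃ l, P l ∧ ¬ P (l + 1) := by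
  by_contra! hc
  have : ∀ n : ℕ, P (i + n) := by
    intro n
    induction n with
    | zero => simpa using hi
    | succ n ih =>
      have := hc _ ih
      push_cast
      rwa [← add_assoc]
  refine hj ?_
  have h := this (j - i).val
  rwa [ZMod.natCast_zmod_val, add_sub_cancel] at h

/-- Going round the cycle, the set is left once and entered once, through different edges. -/
lemma two_le_cycle_cut {r : ℕ} [NeZero r] (T : ZMod r → Bool) {i j : ZMod r} (hi : T i = true)
    (hj : T j = false) : 2 ≤ ∑ l, (T l ^^ T (l + 1)).toNat := by
  classical
  obtain ⟨a, ha, ha'⟩ := exists_boundary (fun l => T l = true) (j := j) hi (by simp [hj])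
  obtain ⟨b, hb, hb'⟩ := exists_boundary (fun l => T l = false) (j := i) hj (by simp [hi])
  have hab : a ≠ b := by
    rintro rfl
    simp_all
  have h3 := Finset.sum_le_sum_of_subset
    (f := fun l => (T l ^^ T (l + 1)).toNat) (Finset.subset_univ {a, b})
  rw [Finset.sum_pair hab] at h3
  simp at ha' hb'
  simpa [ha, ha', hb, hb'] using h3

/-- A set that splits the rim cuts two places of the cycle, hence `2k` edges, and a spoke. If the
rim is not split, oddness separates it from the hub and all `2k + 1` spokes are cut. -/
lemma wheel_isR {k : ℕ} (hk : 1 ≤ k) : (wheel (2 * k + 1) k).IsR (2 * k + 1) where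
  ne := by
    have : Fact (1 < 2 * k + 1) := ⟨by omega⟩
    rintro (i | ⟨i, d⟩) <;> simp [wheel]
  deg := by
    rintro (_ | i)
    · simp [wdeg, wheel, delta, ZMod.card]
    · have : ∀ x, x + 1 = i ↔ x = i - 1 := fun x => eq_sub_iff_add_eq.symm
      rw [wdeg, Fintype.sum_sum_type, Fintype.sum_prod_type]
      simp [wheel, delta, this, mul_add, Finset.sum_add_distrib]
      ring
  le_cut S hS := by
    classical
    set T : ZMod (2 * k + 1) → Bool := fun i => S (some i) with hT
    have h1 : size S = (S none).toNat + ∑ i, (T i).toNat := by simp [size, hT]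
    have h2 : (wheel (2 * k + 1) k).cut (wheel (2 * k + 1) k).mult S =
        ∑ i, (S none ^^ T i).toNat + k * ∑ i, (T i ^^ T (i + 1)).toNat := by
      simp [cut, wheel, Fintype.sum_prod_type, hT, Finset.mul_sum]
    rw [h2]
    rw [h1] at hS
    by_cases hc : (∃ i, T i = true) ∧ ∃ j, T j = false
    · obtain ⟨⟨i, hi⟩, j, hj⟩ := hc
      have h3 := two_le_cycle_cut T hi hj
      have h4 : 1 ≤ ∑ i, (S none ^^ T i).toNat := by
        cases hS0 : S none
        · have := Finset.single_le_sum (f := fun i => (false ^^ T i).toNat)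
            (fun _ _ => Nat.zero_le _) (Finset.mem_univ i)
          simpa [hi] using this
        · have := Finset.single_le_sum (f := fun i => (true ^^ T i).toNat)
            (fun _ _ => Nat.zero_le _) (Finset.mem_univ j)
          simpa [hj] using this
      nlinarith
    · have hconst : ∃ b, ∀ i, T i = b := by
        by_cases h : ∃ i, T i = true
        · refine ⟨true, fun j => ?_⟩
          by_contra hj
          exact hc ⟨h, j, by simpa using hj⟩
        · exact ⟨false, fun j => by by_contra hj; exact h ⟨j, by simpa using hj⟩⟩
      obtain ⟨b, hb⟩ := hconst
      simp only [hb] at hS ⊢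
      revert hS
      cases S none <;> cases b <;> simp [ZMod.card, parity_simps]

/-- Serves two purposes: with one spoke in `Φ` the wheel becomes a gadget rooted there; with `Φ`
empty and the hub in `Z` it carries the final rotation graph. -/
lemma wheel_layered {r k n : ℕ} (Φ : ZMod r → Prop) (Z : Option (ZMod r) → Prop)
    (hZ : ∀ i, ¬ Z (some i)) (h0 : (Z none ∧ ∀ e, ¬ Φ e) ∨ (¬ Z none ∧ ∃! e, Φ e)) :
    (wheel r k).keep.Layered (fun v => v.elim (n + 2) fun _ => n + 1) Φ Z where
  pos v := by cases v <;> simp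
  level e _ := by simp [wheel, keep]
  up v hv := by
    rcases v with _ | i
    · obtain ⟨e, he, hu⟩ := (h0.resolve_left fun h => hv h.1).2
      refine ⟨e, by simp [Up, keep, wheel, he], fun e' he' => hu e' ?_⟩
      simpa [Up, keep, wheel] using he'
    · refine ⟨i, by simp [Up, keep, wheel], fun e' he' => ?_⟩
      simp [Up, keep, wheel] at he'
      exact he'
  top v hv := by
    rcases v with _ | i
    · have := h0.resolve_right fun h => h.1 hv
      simp [Up, keep, wheel, this.2]
    · exact absurd hv (hZ i)
  simple e e' _ _ hp := by simpa [Parallel, keep, wheel] using hp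

/-- Replace all cycle edges of a wheel. -/
noncomputable def Gadget.wheel {k n : ℕ} (hk : 1 ≤ k) (g : Gadget (2 * k + 1) n n) :
    Gadget (2 * k + 1) (n + 2) (n + 1) :=
  Gadget.subst (B := WGraph.wheel (2 * k + 1) k) (h := fun v => v.elim (n + 2) fun _ => n + 1)
    (m := fun _ => n) (n := fun _ => n) (by omega) (wheel_isR hk) (fun _ => rfl) 0
    (wheel_layered _ _ (fun _ h => h) (.inr ⟨id, 0, rfl, fun _ h => h⟩))
    (fun _ => g) (fun _ => rfl) (fun _ => rfl) rfl rfl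

end star

/-! ### Restriction of Berge covers, and embedding a connected graph in a gadget -/

section transfer

variable {V E₀ I : Type} {VK EK : I → Type} [Fintype V] [Fintype E₀] [Fintype I]
  [∀ i, Fintype (VK i)] [∀ i, Fintype (EK i)] {B : WGraph V (E₀ ⊕ I)}
  {K : ∀ i, WGraph (VK i) (EK i)} {f : ∀ i, EK i} {r : ℕ}

lemma HasBerge.subst_base (hr : 0 < r) (hK : ∀ i, (K i).IsR r)
    (h : (subst B K f).HasBerge r) : B.HasBerge r := by
  obtain ⟨x, hx, hc⟩ := h
  exact ⟨fun i e => x i (.inl e), fun i => (hx i).subst_base hr hK, fun e => hc _⟩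

lemma HasBerge.subst_gadget (hr : 0 < r) (hK : ∀ i, (K i).IsR r)
    (h : (subst B K f).HasBerge r) (i : I) : (K i).HasBerge r := by
  obtain ⟨x, hx, hc⟩ := h
  exact ⟨fun j k => x j (.inr ⟨i, k⟩), fun j => (hx j).subst_gadget hr hK i, fun k => hc _⟩

lemma HasBerge.of_reindex {E E' : Type} [Fintype E] [Fintype E'] {W : WGraph V E} {σ : E' ≃ E}
    (h : (W.reindex σ).HasBerge r) : W.HasBerge r := by
  obtain ⟨x, hx, hc⟩ := h
  exact ⟨fun i e => x i (σ.symm e), fun i => (hx i).of_reindex, fun e => hc _⟩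

end transfer

section levels

variable {V E : Type}

/-- The simple graph underlying `W`. -/
def adjGraph (W : WGraph V E) : SimpleGraph V :=
  SimpleGraph.fromRel fun u v => ∃ e, W.src e = u ∧ W.tgt e = v

lemma adjGraph_adj (W : WGraph V E) {e : E} (he : W.src e ≠ W.tgt e) :
    W.adjGraph.Adj (W.src e) (W.tgt e) := by
  simp only [adjGraph, SimpleGraph.fromRel_adj]
  exact ⟨he, .inl ⟨e, rfl, rfl⟩⟩

lemma exists_edge_of_adj {W : WGraph V E} {u v : V} (h : W.adjGraph.Adj u v) :
    ∃ e, (W.src e = u ∧ W.tgt e = v) ∨ (W.tgt e = u ∧ W.src e = v) := by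
  simp only [adjGraph, SimpleGraph.fromRel_adj] at h
  obtain ⟨-, ⟨e, he⟩ | ⟨e, he⟩⟩ := h
  · exact ⟨e, .inl he⟩
  · exact ⟨e, .inr he.symm⟩

/-- The distance from the set `{a, b}`. -/
lemma exists_levels {W : WGraph V E} (hne : ∀ e, W.src e ≠ W.tgt e) (hW : W.adjGraph.Connected)
    (a b : V) : ∃ l : V → ℕ, (∀ v, l v = 0 ↔ v = a ∨ v = b) ∧
      (∀ e, l (W.src e) ≤ l (W.tgt e) + 1 ∧ l (W.tgt e) ≤ l (W.src e) + 1) ∧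
      ∀ v, l v ≠ 0 → ∃ e, (W.src e = v ∧ l (W.tgt e) + 1 = l v) ∨
        (W.tgt e = v ∧ l (W.src e) + 1 = l v) := by
  have lip : ∀ c u v, W.adjGraph.Adj u v → W.adjGraph.dist u c ≤ W.adjGraph.dist v c + 1 := by
    intro c u v h
    have := hW.dist_triangle (u := u) (v := v) (w := c)
    rw [SimpleGraph.dist_eq_one_iff_adj.2 h] at this
    omega
  have step : ∀ c v, W.adjGraph.dist v c ≠ 0 → ∃ w, W.adjGraph.Adj v w ∧
      W.adjGraph.dist w c + 1 = W.adjGraph.dist v c := by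
    intro c v hv
    obtain ⟨p, hp⟩ := hW.exists_walk_length_eq_dist v c
    cases p with
    | nil => simp at hv
    | cons h q =>
      refine ⟨_, h, ?_⟩
      have h1 := SimpleGraph.dist_le q
      have h2 := lip c _ _ h
      rw [SimpleGraph.Walk.length_cons] at hp
      omega
  have lip' : ∀ u v, W.adjGraph.Adj u v → min (W.adjGraph.dist u a) (W.adjGraph.dist u b) ≤
      min (W.adjGraph.dist v a) (W.adjGraph.dist v b) + 1 := by
    intro u v h
    have := lip a u v h
    have := lip b u v h
    omega
  refine ⟨fun v => min (W.adjGraph.dist v a) (W.adjGraph.dist v b), fun v => ?_, fun e =>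
    ⟨lip' _ _ (W.adjGraph_adj (hne e)), lip' _ _ (W.adjGraph_adj (hne e)).symm⟩, fun v hv => ?_⟩
  · change min (W.adjGraph.dist v a) (W.adjGraph.dist v b) = 0 ↔ _
    rw [← hW.dist_eq_zero_iff (u := v) (v := a), ← hW.dist_eq_zero_iff (u := v) (v := b)]
    omega
  · change min (W.adjGraph.dist v a) (W.adjGraph.dist v b) ≠ 0 at hv
    have : ∃ w, W.adjGraph.Adj v w ∧ min (W.adjGraph.dist w a) (W.adjGraph.dist w b) + 1 =
        min (W.adjGraph.dist v a) (W.adjGraph.dist v b) := by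
      rcases le_total (W.adjGraph.dist v a) (W.adjGraph.dist v b) with h | h
      · obtain ⟨w, hw, hd⟩ := step a v (by omega)
        have := lip' v w hw
        exact ⟨w, hw, by omega⟩
      · obtain ⟨w, hw, hd⟩ := step b v (by omega)
        have := lip' v w hw
        exact ⟨w, hw, by omega⟩
    obtain ⟨w, hw, hd⟩ := this
    obtain ⟨e, ⟨rfl, rfl⟩ | ⟨rfl, rfl⟩⟩ := exists_edge_of_adj hw
    · exact ⟨e, .inl ⟨rfl, hd⟩⟩
    · exact ⟨e, .inr ⟨rfl, hd⟩⟩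

end levels

/-- Breadth-first levels of adjacent vertices differ by at most one, so these are all the gadgets
needed. Unequal levels come from a wheel rooted at a spoke. -/
lemma nonempty_gadget_of_close {k : ℕ} (hk : 1 ≤ k) {m n : ℕ} (hm : 3 ≤ m) (hn : 3 ≤ n)
    (h1 : m ≤ n + 1) (h2 : n ≤ m + 1) : Nonempty (Gadget (2 * k + 1) m n) := by
  obtain rfl | rfl | rfl : m = n ∨ m = n + 1 ∨ n = m + 1 := by omega
  · exact nonempty_gadget (by omega) m (by omega)
  · obtain ⟨c, rfl⟩ : ∃ c, n = c + 1 := ⟨n - 1, by omega⟩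
    exact (nonempty_gadget (by omega) c (by omega)).map fun g => g.wheel hk
  · obtain ⟨c, rfl⟩ : ∃ c, m = c + 1 := ⟨m - 1, by omega⟩
    exact (nonempty_gadget (by omega) c (by omega)).map fun g => (g.wheel hk).swap

/-- Every connected `r`-graph is a reduction of a gadget. -/
theorem exists_gadget {V E : Type} [Fintype V] [Fintype E] {W : WGraph V E} {k : ℕ} (hk : 1 ≤ k)
    (hW : W.IsR (2 * k + 1)) (hm : ∀ e, W.mult e = 1) (hc : W.adjGraph.Connected) :
    ∃ n, ∃ g : Gadget (2 * k + 1) n n,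
      g.graph.HasBerge (2 * k + 1) → W.HasBerge (2 * k + 1) := by
  classical
  obtain ⟨v₀⟩ := hc.nonempty
  obtain ⟨f, -⟩ : ∃ f ∈ Finset.univ, W.mult f * (delta v₀ (W.src f) + delta v₀ (W.tgt f)) ≠ 0 := by
    refine Finset.exists_ne_zero_of_sum_ne_zero ?_
    have := hW.deg v₀
    rw [wdeg] at this
    omega
  obtain ⟨l, h0, hl, hp⟩ := exists_levels hW.ne hc (W.src f) (W.tgt f)
  have : Nonempty E := ⟨f⟩
  choose! p hp using hp
  -- The edges to keep: `f` and one parent edge for each vertex off `f`. Contracting `f` would turn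
  -- this into a breadth-first tree; all other edges are replaced.
  set tr : E → Prop := fun e => e = f ∨ ∃ v, l v ≠ 0 ∧ p v = e with htr
  have hlt : ∀ v, l v ≤ Finset.univ.sup l := fun v => Finset.le_sup (Finset.mem_univ v)
  -- The summand 4 keeps every vertex on level at least 4, so that the gadgets one level below have
  -- root ends on levels at least 3.
  set D := Finset.univ.sup l + 4 with hD
  set B := W.reindex (Equiv.sumCompl tr) with hB
  have hBl : B.keep.Layered (fun v => D - l v) (· = (⟨f, .inl rfl⟩ : {e // tr e}))
      fun _ => False := by
    constructor
    · intro v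
      have := hlt v
      omega
    · rintro ⟨e, rfl | ⟨v, hv, rfl⟩⟩ he
      · exact absurd rfl he
      · change D - l (W.tgt (p v)) = D - l (W.src (p v)) + 1 ∨
          D - l (W.src (p v)) = D - l (W.tgt (p v)) + 1 ∨ _
        have h1 := hlt (W.src (p v))
        have h2 := hlt (W.tgt (p v))
        rcases hp v hv with ⟨h3, h4⟩ | ⟨h3, h4⟩
        · rw [h3] at h1 ⊢
          left
          omega
        · rw [h3] at h2 ⊢
          right; left
          omega
    · intro v _
      by_cases hv : l v = 0
      · refine ⟨⟨f, .inl rfl⟩, ?_, ?_⟩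
        · rcases (h0 v).1 hv with h | h
          · exact .inl ⟨h.symm, .inl rfl⟩
          · exact .inr ⟨h.symm, .inl rfl⟩
        · rintro ⟨e, he⟩ hu
          by_contra hef
          have := hlt v
          rcases hu with ⟨h1, h2 | h2⟩ | ⟨h1, h2 | h2⟩
          · exact hef h2
          · have h3 := hlt (W.tgt e)
            change D - l (W.tgt e) = D - l v + 1 at h2
            omega
          · exact hef h2
          · have h3 := hlt (W.src e)
            change D - l (W.src e) = D - l v + 1 at h2
            omega
      · refine ⟨⟨p v, .inr ⟨v, hv, rfl⟩⟩, ?_, ?_⟩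
        · rcases hp v hv with ⟨h3, h4⟩ | ⟨h3, h4⟩
          · refine .inl ⟨h3, .inr ?_⟩
            change D - l (W.tgt (p v)) = D - l v + 1
            have := hlt v
            omega
          · refine .inr ⟨h3, .inr ?_⟩
            change D - l (W.src (p v)) = D - l v + 1
            have := hlt v
            omega
        · rintro ⟨e, he⟩ hu
          have hnf : e ≠ f := by
            rintro rfl
            refine hv ((h0 v).2 ?_)
            rcases hu with ⟨h1, -⟩ | ⟨h1, -⟩
            · exact .inl h1.symm
            · exact .inr h1.symm
          have hval : ∀ q, l q ≠ 0 → p q = e → q = v := by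
            rintro q hq rfl
            have hu' : (W.src (p q) = v ∧ D - l (W.tgt (p q)) = D - l v + 1) ∨
                (W.tgt (p q) = v ∧ D - l (W.src (p q)) = D - l v + 1) := by
              rcases hu with ⟨h1, h2⟩ | ⟨h1, h2⟩
              · exact .inl ⟨h1, h2.resolve_left fun h => hnf (congrArg Subtype.val h)⟩
              · exact .inr ⟨h1, h2.resolve_left fun h => hnf (congrArg Subtype.val h)⟩
            have h5 := hlt v
            rcases hp q hq with ⟨h3, h4⟩ | ⟨h3, h4⟩ <;>
              rcases hu' with ⟨h1, h2⟩ | ⟨h1, h2⟩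
            · exact h3.symm.trans h1
            · rw [h3] at h2
              rw [h1] at h4
              omega
            · rw [h3] at h2
              rw [h1] at h4
              omega
            · exact h3.symm.trans h1
          rcases he with he | ⟨q, hq, rfl⟩
          · exact absurd he hnf
          · exact Subtype.ext (congrArg p (hval q hq rfl))
    · exact fun _ h => h.elim
    · have hval : ∀ q q', l q ≠ 0 → l q' ≠ 0 → W.Parallel (p q) (p q') → q = q' := by
        intro q q' hq hq' hpar
        rcases hp q hq with ⟨h1, h2⟩ | ⟨h1, h2⟩ <;> rcases hp q' hq' with ⟨h3, h4⟩ | ⟨h3, h4⟩ <;>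
          rcases hpar with ⟨h5, h6⟩ | ⟨h5, h6⟩
        · exact h1.symm.trans (h5.trans h3)
        · rw [h6, h3] at h2; rw [← h5, h1] at h4; omega
        · rw [h6, h3] at h2; rw [← h5, h1] at h4; omega
        · exact h1.symm.trans (h5.trans h3)
        · rw [h5, h3] at h2; rw [← h6, h1] at h4; omega
        · exact h1.symm.trans (h6.trans h3)
        · exact h1.symm.trans (h6.trans h3)
        · rw [h5, h3] at h2; rw [← h6, h1] at h4; omega
      rintro ⟨e, he⟩ ⟨e', he'⟩ hne hne' hpar
      rcases he with rfl | ⟨q, hq, rfl⟩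
      · exact absurd rfl hne
      rcases he' with rfl | ⟨q', hq', rfl⟩
      · exact absurd rfl hne'
      exact Subtype.ext (congrArg p (hval q q' hq hq' hpar))
  have hg : ∀ i : {e // ¬ tr e}, Nonempty (Gadget (2 * k + 1) (D - l (W.tgt i) - 1)
      (D - l (W.src i) - 1)) := by
    intro i
    have h1 := hlt (W.src i)
    have h2 := hlt (W.tgt i)
    have h3 := hl i
    exact nonempty_gadget_of_close hk (by omega) (by omega) (by omega) (by omega)
  set g := fun i => (hg i).some
  have hpos : ∀ v, 4 ≤ D - l v := fun v => by
    have := hlt v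
    omega
  refine ⟨D, Gadget.subst (by omega) (hW.reindex (σ := Equiv.sumCompl tr))
    (fun e => hm _) _ hBl g (fun i => ?_) (fun i => ?_) ?_ ?_, fun hberge => ?_⟩
  · exact Nat.sub_add_cancel ((hpos _).trans' (by omega))
  · exact Nat.sub_add_cancel ((hpos _).trans' (by omega))
  · change D - l (W.src f) = D
    rw [(h0 _).2 (.inl rfl), Nat.sub_zero]
  · change D - l (W.tgt f) = D
    rw [(h0 _).2 (.inr rfl), Nat.sub_zero]
  · exact (HasBerge.subst_base (by omega) (fun i => (g i).isR) hberge).of_reindex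

/-! ### Reduction to connected graphs -/

section component

variable {V E C : Type}

/-- The part of `W` on the vertices that `κ` maps to `c`. -/
def fiber (W : WGraph V E) (κ : V → C) (hκ : ∀ e, κ (W.src e) = κ (W.tgt e)) (c : C) :
    WGraph {v // κ v = c} {e // κ (W.src e) = c} where
  src e := ⟨W.src e, e.2⟩
  tgt e := ⟨W.tgt e, (hκ e).symm.trans e.2⟩
  mult e := W.mult e

open scoped Classical in
lemma sum_subtype_eq {X : Type} [Fintype X] (p : X → Prop) (F : X → ℕ)
    (hF : ∀ a, ¬ p a → F a = 0) : ∑ a : {a // p a}, F a = ∑ a, F a := by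
  rw [← Finset.sum_subtype (Finset.univ.filter p) (by simp) F, Finset.sum_filter]
  refine Finset.sum_congr rfl fun a _ => ?_
  split_ifs with h
  · rfl
  · exact (hF a h).symm

variable [Fintype E] {W : WGraph V E} {κ : V → C} {hκ : ∀ e, κ (W.src e) = κ (W.tgt e)} {c : C}

open scoped Classical in
lemma fiber_wdeg (y : E → ℕ) (v : {v // κ v = c}) :
    (W.fiber κ hκ c).wdeg (fun e => y e) v = W.wdeg y v := by
  rw [wdeg, wdeg, ← sum_subtype_eq (fun e => κ (W.src e) = c)]
  · refine Finset.sum_congr rfl fun e _ => ?_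
    have h : ∀ w : {v // κ v = c}, delta v w = delta v.1 w.1 := fun w =>
      (delta_map Subtype.val_injective v w).symm
    simp only [fiber, h]
  · intro e he
    have h1 : W.src e ≠ v := fun h => he (by rw [h, v.2])
    have h2 : W.tgt e ≠ v := fun h => he (by rw [hκ, h, v.2])
    rw [delta_of_ne h1, delta_of_ne h2, add_zero, mul_zero]

open scoped Classical in
lemma IsR.fiber [Fintype V] {r : ℕ} (h : W.IsR r) : (W.fiber κ hκ c).IsR r where
  ne e he := h.ne e (congrArg Subtype.val he)
  deg v := (fiber_wdeg W.mult v).trans (h.deg v)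
  le_cut S hS := by
    set S' : V → Bool := fun v => if hv : κ v = c then S ⟨v, hv⟩ else false with hS'
    have h1 : ∀ v : {v // κ v = c}, S v = S' v := fun v => by simp [hS', v.2]
    have h2 : size S = size S' := by
      rw [size, size, ← sum_subtype_eq (fun v => κ v = c)]
      · exact Finset.sum_congr rfl fun v _ => by rw [h1]
      · intro v hv
        simp [hS', hv]
    rw [h2] at hS
    refine (h.le_cut S' hS).trans (le_of_eq ?_)
    rw [cut, cut, ← sum_subtype_eq (fun e => κ (W.src e) = c)]
    · refine Finset.sum_congr rfl fun e _ => ?_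
      rw [h1, h1]
      rfl
    · intro e he
      simp [hS', he, ← hκ e]

-- All parts have covers by the same number `2r - 1` of matchings, so matchings with equal index can
-- be united.
open scoped Classical in
lemma HasBerge.of_fiber {r : ℕ} (h : ∀ c, (W.fiber κ hκ c).HasBerge r) : W.HasBerge r := by
  choose x hx hc using h
  refine ⟨fun i e => x (κ (W.src e)) i ⟨e, rfl⟩, fun i v => ?_, fun e => hc _ _⟩
  refine Eq.trans ?_ (hx (κ v) i ⟨v, rfl⟩)
  refine (fiber_wdeg (κ := κ) (hκ := hκ) (c := κ v) _ ⟨v, rfl⟩).symm.trans ?_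
  refine congrArg (fun y => (W.fiber κ hκ (κ v)).wdeg y ⟨v, rfl⟩) (funext fun e => ?_)
  obtain ⟨e, he⟩ := e
  have : ∀ c (he : κ (W.src e) = c), x (κ (W.src e)) i ⟨e, rfl⟩ = x c i ⟨e, he⟩ := by
    rintro _ rfl
    rfl
  exact this _ he

end component

open scoped Classical in
lemma HasBerge.of_connected {V E : Type} [Fintype V] [Fintype E] {W : WGraph V E} {r : ℕ}
    (hW : W.IsR r) (hm : ∀ e, W.mult e = 1)
    (h : ∀ (V E : Type) [Fintype V] [Fintype E] (W : WGraph V E), W.IsR r → (∀ e, W.mult e = 1) →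
      W.adjGraph.Connected → W.HasBerge r) : W.HasBerge r := by
  have hκ : ∀ e, W.adjGraph.connectedComponentMk (W.src e) =
      W.adjGraph.connectedComponentMk (W.tgt e) := fun e =>
    SimpleGraph.ConnectedComponent.sound (W.adjGraph_adj (hW.ne e)).reachable
  refine HasBerge.of_fiber (κ := W.adjGraph.connectedComponentMk) (hκ := hκ) fun c => ?_
  refine h _ _ _ hW.fiber (fun e => hm e) ?_
  refine SimpleGraph.Connected.map (H := (W.fiber _ hκ c).adjGraph)
    ⟨fun v => ⟨v.1, v.2⟩, fun {a b} hab => ?_⟩ (fun v => ⟨⟨v.1, v.2⟩, rfl⟩)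
    c.connected_toSimpleGraph
  have hab' : W.adjGraph.Adj a.1 b.1 := hab
  obtain ⟨e, ⟨h1, h2⟩ | ⟨h1, h2⟩⟩ := exists_edge_of_adj hab'
  · have := (W.fiber _ hκ c).adjGraph_adj (hW.fiber.ne ⟨e, by rw [h1]; exact a.2⟩)
    convert! this using 1
    · exact Subtype.ext h1.symm
    · exact Subtype.ext h2.symm
  · have := (W.fiber _ hκ c).adjGraph_adj (hW.fiber.ne ⟨e, by rw [h2]; exact b.2⟩)
    convert! this.symm using 1
    · exact Subtype.ext h1.symm
    · exact Subtype.ext h2.symm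

/-! ### The spanning tree of a layered graph -/

section rotation

variable {V E : Type}

/-- The edges between different levels. -/
def treeGraph (W : WGraph V E) (h : V → ℕ) : Graph V E where
  vertexSet := Set.univ
  IsLink e x y := W.toGraph.IsLink e x y ∧ h x ≠ h y
  isLink_symm e _ := ⟨fun _ _ h => ⟨h.1.symm, h.2.symm⟩⟩
  eq_or_eq_of_isLink_of_isLink _ _ _ _ _ h h' := h.1.left_eq_or_eq h'.1
  left_mem_of_isLink _ _ _ _ := Set.mem_univ _

variable {W : WGraph V E} {h : V → ℕ} {z : V}

lemma treeGraph_isLink {e : E} {x y : V} :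
    (W.treeGraph h).IsLink e x y ↔ W.toGraph.IsLink e x y ∧ h x ≠ h y := Iff.rfl

lemma treeGraph_le : W.treeGraph h ≤s W.toGraph where
  le := ⟨subset_rfl, fun _ _ _ h => h.1⟩
  vertexSet_eq := rfl

lemma Layered.toGraph_simple (hL : W.Layered h (fun _ => False) (· = z))
    (hne : ∀ e, W.src e ≠ W.tgt e) : W.toGraph.Simple where
  not_isLoopAt := (W.toGraph_represents.ne_iff.1 hne).not_isLoopAt
  eq_of_isLink e f x y he hf := by
    refine hL.simple e f id id ?_
    rcases he with ⟨rfl, rfl⟩ | ⟨rfl, rfl⟩ <;> rcases hf with ⟨h1, h2⟩ | ⟨h1, h2⟩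
    · exact .inl ⟨h1.symm, h2.symm⟩
    · exact .inr ⟨h2.symm, h1.symm⟩
    · exact .inr ⟨h2.symm, h1.symm⟩
    · exact .inl ⟨h1.symm, h2.symm⟩

lemma Layered.level_isLink (hL : W.Layered h (fun _ => False) (· = z)) {e : E} {x y : V}
    (he : W.toGraph.IsLink e x y) : h y = h x + 1 ∨ h x = h y + 1 ∨ (h x = 1 ∧ h y = 1) := by
  have := hL.level e id
  rcases he with ⟨rfl, rfl⟩ | ⟨rfl, rfl⟩ <;> tauto

lemma up_iff {v : V} {e : E} :
    W.Up h (fun _ => False) v e ↔ ∃ w, W.toGraph.IsLink e v w ∧ h w = h v + 1 := by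
  constructor
  · rintro (⟨rfl, h1⟩ | ⟨rfl, h1⟩)
    · exact ⟨_, .inl ⟨rfl, rfl⟩, h1.resolve_left id⟩
    · exact ⟨_, .inr ⟨rfl, rfl⟩, h1.resolve_left id⟩
  · rintro ⟨w, ⟨rfl, rfl⟩ | ⟨rfl, rfl⟩, h1⟩
    · exact .inl ⟨rfl, .inr h1⟩
    · exact .inr ⟨rfl, .inr h1⟩

/-- Horizontal edges occur on level 1 only, so no edge at a higher vertex is discarded. -/
lemma Layered.vertexDegree_of_two_le (hL : W.Layered h (fun _ => False) (· = z)) {v : V}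
    (hv : 2 ≤ h v) : (W.treeGraph h).vertexDegree v = W.toGraph.vertexDegree v := by
  rw [Graph.vertexDegree, Graph.vertexDegree]
  congr 1
  ext e
  constructor
  · rintro ⟨w, hw, -⟩
    exact ⟨w, hw⟩
  · rintro ⟨w, hw⟩
    refine ⟨w, hw, ?_⟩
    have := hL.level_isLink hw
    omega

lemma Layered.vertexDegree_of_eq_one (hL : W.Layered h (fun _ => False) (· = z)) {v : V}
    (hv : h v = 1) (hz : v ≠ z) : (W.treeGraph h).vertexDegree v = 1 := by
  obtain ⟨e, he, hu⟩ := hL.up v hz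
  rw [Graph.vertexDegree, Set.ncard_eq_one]
  refine ⟨e, ?_⟩
  ext e'
  rw [Set.mem_singleton_iff]
  constructor
  · rintro ⟨w, hw, hne⟩
    refine hu e' (up_iff.2 ⟨w, hw, ?_⟩)
    have := hL.level_isLink hw
    have := hL.pos w
    omega
  · rintro rfl
    obtain ⟨w, hw, h1⟩ := up_iff.1 he
    exact ⟨w, hw, by omega⟩

lemma treeGraph_adj {u w : (W.treeGraph h).vertexSet} :
    (W.treeGraph h).toSimpleGraph.Adj u w ↔
      ∃ e, W.toGraph.IsLink e u w ∧ h u ≠ h w := by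
  rw [Graph.toSimpleGraph_adj]
  constructor
  · rintro ⟨-, e, he⟩
    exact ⟨e, he⟩
  · rintro ⟨e, he, hne⟩
    exact ⟨fun hc => hne (by rw [hc]), e, he, hne⟩

variable [Fintype V]

/-- Climb along the upward edges. Levels are bounded and only `z` has no upward edge, so the climb
ends at `z`; `n` bounds the levels still available above `u`. -/
lemma Layered.exists_walk (hL : W.Layered h (fun _ => False) (· = z)) :
    ∀ (n : ℕ) (u : V), Finset.univ.sup h ≤ h u + n →
    ∃ p : (W.treeGraph h).toSimpleGraph.Walk ⟨z, Set.mem_univ _⟩ ⟨u, Set.mem_univ _⟩,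
      p.length + h u = h z := by
  intro n
  induction n with
  | zero =>
    intro u hu
    by_cases huz : u = z
    · subst huz
      exact ⟨.nil, by simp⟩
    · obtain ⟨e, he, -⟩ := hL.up u huz
      obtain ⟨w, -, hw⟩ := up_iff.1 he
      have := Finset.le_sup (f := h) (Finset.mem_univ w)
      omega
  | succ n ih =>
    intro u hu
    by_cases huz : u = z
    · subst huz
      exact ⟨.nil, by simp⟩
    · obtain ⟨e, he, -⟩ := hL.up u huz
      obtain ⟨w, hl, hw⟩ := up_iff.1 he
      obtain ⟨p, hp⟩ := ih w (by omega)
      have hadj : (W.treeGraph h).toSimpleGraph.Adj ⟨w, Set.mem_univ _⟩ ⟨u, Set.mem_univ _⟩ :=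
        treeGraph_adj.2 ⟨e, hl.symm, by dsimp only; omega⟩
      exact ⟨p.concat hadj, by rw [SimpleGraph.Walk.length_concat]; omega⟩

lemma Layered.walk_length (hL : W.Layered h (fun _ => False) (· = z))
    {u w : (W.treeGraph h).vertexSet} (p : (W.treeGraph h).toSimpleGraph.Walk u w) :
    h u ≤ p.length + h w := by
  induction p with
  | nil => simp
  | cons hadj p ih =>
    obtain ⟨e, he, -⟩ := treeGraph_adj.1 hadj
    have := hL.level_isLink he
    rw [SimpleGraph.Walk.length_cons]
    omega

lemma Layered.dist_add (hL : W.Layered h (fun _ => False) (· = z))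
    (u : (W.treeGraph h).vertexSet) :
    (W.treeGraph h).toSimpleGraph.dist ⟨z, Set.mem_univ _⟩ u + h u = h z := by
  obtain ⟨p, hp⟩ := hL.exists_walk _ u.1 (Nat.le_add_left _ _)
  obtain ⟨q, hq⟩ := p.reachable.exists_walk_length_eq_dist
  have h1 := SimpleGraph.dist_le p
  have h2 := hL.walk_length q
  change (W.treeGraph h).toSimpleGraph.dist ⟨z, Set.mem_univ _⟩ u ≤ p.length at h1
  change q.length = (W.treeGraph h).toSimpleGraph.dist ⟨z, Set.mem_univ _⟩ u at hq
  change h z ≤ q.length + h u at h2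
  omega

/-- The graph is connected through `z`, and each of its edges is the upward edge of its lower end.
Hence there are at most as many edges as vertices other than `z`. -/
lemma Layered.treeGraph_isTree (hL : W.Layered h (fun _ => False) (· = z))
    (hne : ∀ e, W.src e ≠ W.tgt e) : (W.treeGraph h).IsTree := by
  classical
  have hs := hL.toGraph_simple hne
  refine ⟨Graph.Simple.anti (G := W.toGraph) treeGraph_le.le, ?_⟩
  have hconn : (W.treeGraph h).toSimpleGraph.Connected := by
    have : Nonempty (W.treeGraph h).vertexSet := ⟨⟨z, Set.mem_univ _⟩⟩
    refine SimpleGraph.Connected.mk fun u w => ?_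
    obtain ⟨p, -⟩ := hL.exists_walk _ u.1 (Nat.le_add_left _ _)
    obtain ⟨q, -⟩ := hL.exists_walk _ w.1 (Nat.le_add_left _ _)
    exact p.reachable.symm.trans q.reachable
  have hfin : Finite (W.treeGraph h).vertexSet := Subtype.finite
  refine SimpleGraph.isTree_iff_connected_and_card.2 ⟨hconn, ?_⟩
  refine le_antisymm ?_ hconn.card_vert_le_card_edgeSet_add_one
  have hp : ∀ v : {v // v ≠ z}, ∃ w, (∃ e, W.toGraph.IsLink e v w) ∧ h w = h v + 1 ∧
      ∀ e' w', W.toGraph.IsLink e' v w' → h w' = h v + 1 → w' = w := by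
    rintro ⟨v, hv⟩
    obtain ⟨e, he, hu⟩ := hL.up v hv
    obtain ⟨w, hl, hw⟩ := up_iff.1 he
    refine ⟨w, ⟨e, hl⟩, hw, fun e' w' hl' hw' => ?_⟩
    obtain rfl := hu e' (up_iff.2 ⟨w', hl', hw'⟩)
    exact hl'.right_unique hl
  choose p hpl hph hpu using hp
  set F : {v // v ≠ z} → Sym2 (W.treeGraph h).vertexSet :=
    fun v => s(⟨v, Set.mem_univ _⟩, ⟨p v, Set.mem_univ _⟩) with hF
  have hsub : (W.treeGraph h).toSimpleGraph.edgeSet ⊆ Set.range F := by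
    intro s
    induction s with
    | h u w =>
      intro hadj
      rw [SimpleGraph.mem_edgeSet] at hadj
      have key : ∀ u w : (W.treeGraph h).vertexSet, (∃ e, W.toGraph.IsLink e u w) →
          h w = h u + 1 → s(u, w) ∈ Set.range F := by
        rintro u w ⟨e, he⟩ hw
        have huz : u.1 ≠ z := fun hc => hL.top u.1 hc e (up_iff.2 ⟨w.1, he, hw⟩)
        refine ⟨⟨u.1, huz⟩, ?_⟩
        have := hpu ⟨u.1, huz⟩ e w.1 he hw
        simp only [hF, ← this]
      obtain ⟨e, he, hne'⟩ := treeGraph_adj.1 hadj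
      rcases hL.level_isLink he with h1 | h1 | h1
      · exact key u w ⟨e, he⟩ h1
      · rw [Sym2.eq_swap]
        exact key w u ⟨e, he.symm⟩ h1
      · omega
  have h1 : Nat.card (W.treeGraph h).toSimpleGraph.edgeSet ≤ Nat.card {v // v ≠ z} := by
    rw [Nat.card_coe_set_eq]
    refine (Set.ncard_le_ncard hsub (Set.finite_range F)).trans ?_
    rw [← Set.image_univ]
    refine (Set.ncard_image_le).trans ?_
    rw [Set.ncard_univ]
  have h2 : Nat.card {v // v ≠ z} + 1 = Nat.card (W.treeGraph h).vertexSet := by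
    have h3 : Nat.card (W.treeGraph h).vertexSet = Nat.card V := Nat.card_univ
    rw [h3, Nat.card_eq_fintype_card, Nat.card_eq_fintype_card, Fintype.card_subtype_compl]
    have := Fintype.card_pos_iff.2 ⟨z⟩
    simp
    omega
  omega

lemma isAutomorphism_of_equiv (G : Graph V E) (hV : G.vertexSet = Set.univ) (ψ : V ≃ V)
    (ε : E ≃ E) (h : ∀ e x y, G.IsLink (ε e) (ψ x) (ψ y) ↔ G.IsLink e x y) :
    G.IsAutomorphism ψ := by
  refine ⟨hV ▸ Set.bijOn_univ.2 ψ.bijective, fun u _ w _ => ?_⟩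
  have : {e | G.IsLink e (ψ u) (ψ w)} = ε '' {e | G.IsLink e u w} := by
    ext e
    constructor
    · intro he
      exact ⟨ε.symm e, (h _ _ _).1 (by simpa using he), by simp⟩
    · rintro ⟨e, he, rfl⟩
      exact (h _ _ _).2 he
  rw [Graph.numEdges, this, Set.ncard_image_of_injective _ ε.injective, Graph.numEdges]

variable [Fintype E]

/-- A layered `r`-graph with a suitable automorphism is a rotation `r`-graph. -/
theorem Layered.isRotationRGraph {r : ℕ} (hr : 2 ≤ r)
    (hL : W.Layered h (fun _ => False) (· = z)) (hW : W.IsR r) (hm : ∀ e, W.mult e = 1)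
    (hz : 2 ≤ h z) (ψ : V ≃ V) (ε : E ≃ E) (hs : ∀ e, W.src (ε e) = ψ (W.src e))
    (ht : ∀ e, W.tgt (ε e) = ψ (W.tgt e)) (hh : ∀ v, h (ψ v) = h v) (hψ : ψ z = z)
    (hper : ∀ v, v ≠ z → Function.minimalPeriod ψ v = r) : W.toGraph.IsRotationRGraph r := by
  have hR := (W.toGraph_represents.isR_iff hm r).1 hW
  have hlink : ∀ e x y, W.toGraph.IsLink (ε e) (ψ x) (ψ y) ↔ W.toGraph.IsLink e x y := by
    intro e x y
    simp [toGraph_isLink, hs, ht]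
  have hdz : (W.treeGraph h).vertexDegree z = r := by
    rw [hL.vertexDegree_of_two_le hz]
    exact hR.regular z (Set.mem_univ _)
  have hd : ∀ v, 2 ≤ h v → (W.treeGraph h).vertexDegree v = r := fun v hv => by
    rw [hL.vertexDegree_of_two_le hv]
    exact hR.regular v (Set.mem_univ _)
  -- The leaves lie on level 1 and distance to `z` is the difference of levels, so the depth is `h z
  -- - 1`.
  refine ⟨hR, h z - 1, W.treeGraph h, ⟨z, Set.mem_univ _⟩, ψ, treeGraph_le,
    ⟨hL.treeGraph_isTree hW.ne, fun u _ => ?_, hdz, fun u hu hu1 => ?_⟩,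
    isAutomorphism_of_equiv _ rfl ψ ε hlink,
    isAutomorphism_of_equiv _ rfl ψ ε fun e x y => by
      rw [treeGraph_isLink, treeGraph_isLink, hlink, hh, hh],
    Function.minimalPeriod_eq_one_iff_isFixedPt.2 hψ, fun u _ hu => (hper u hu).trans hdz.symm⟩
  · by_cases hu1 : 2 ≤ h u
    · exact .inr (hd u hu1)
    · have := hL.pos u
      by_cases huz : u = z
      · exact .inr (huz ▸ hdz)
      · exact .inl (hL.vertexDegree_of_eq_one (by omega) huz)
  · have h1 := hL.dist_add u
    have h2 := hL.pos u
    have h3 : ¬ 2 ≤ h u := fun h3 => by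
      rw [hd u h3] at hu1
      omega
    omega

end rotation

/-! ### The rotation graph built from a wheel -/

section final

variable {k n : ℕ}

/-- Rotation by one on `ZMod r × D`. -/
def shift (r : ℕ) (D : Type) : ZMod r × D ≃ ZMod r × D :=
  Equiv.prodCongr (Equiv.addRight 1) (Equiv.refl D)

/-- The wheel in which every cycle edge is replaced by the gadget `g`. -/
noncomputable def rotationGraph (g : Gadget (2 * k + 1) n n) :=
  subst (wheel (2 * k + 1) k) (fun _ => g.graph) fun _ => g.root

/-- The rotation on vertices. -/
def rotV (k : ℕ) (X : Type) :
    (Option (ZMod (2 * k + 1)) ⊕ Σ _ : ZMod (2 * k + 1) × Fin k, X) ≃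
      (Option (ZMod (2 * k + 1)) ⊕ Σ _ : ZMod (2 * k + 1) × Fin k, X) :=
  Equiv.sumCongr (Equiv.optionCongr (Equiv.addRight 1))
    (Equiv.sigmaCongr (shift _ _) fun _ => Equiv.refl X)

/-- The rotation on edges. -/
def rotE (k : ℕ) (X : Type) :
    ((ZMod (2 * k + 1) ⊕ ZMod (2 * k + 1) × Fin k) ⊕ Σ _ : ZMod (2 * k + 1) × Fin k, X) ≃
      ((ZMod (2 * k + 1) ⊕ ZMod (2 * k + 1) × Fin k) ⊕ Σ _ : ZMod (2 * k + 1) × Fin k, X) :=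
  Equiv.sumCongr (Equiv.sumCongr (Equiv.addRight 1) (shift _ _))
    (Equiv.sigmaCongr (shift _ _) fun _ => Equiv.refl X)

/-- Away from the hub every vertex carries a coordinate in `ZMod (2 * k + 1)` that grows by one in
each step, so it returns exactly at the multiples of `2k + 1`. -/
lemma rotV_minimalPeriod {X : Type} {v : Option (ZMod (2 * k + 1)) ⊕
      Σ _ : ZMod (2 * k + 1) × Fin k, X} (hv : v ≠ .inl none) :
    Function.minimalPeriod (rotV k X) v = 2 * k + 1 := by
  have key : ∀ m : ℕ, (rotV k X)^[m] v = v ↔ (m : ZMod (2 * k + 1)) = 0 := by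
    rcases v with (_ | i) | ⟨⟨i, d⟩, x⟩
    · exact absurd rfl hv
    · have : ∀ m : ℕ, (rotV k X)^[m] (.inl (some i)) = .inl (some (i + m)) := by
        intro m
        induction m with
        | zero => simp
        | succ m ih =>
          rw [Function.iterate_succ_apply', ih]
          simp [rotV, add_assoc]
      intro m
      rw [this]
      simp
    · have : ∀ m : ℕ, (rotV k X)^[m] (.inr ⟨(i, d), x⟩) = .inr ⟨(i + m, d), x⟩ := by
        intro m
        induction m with
        | zero => simp
        | succ m ih =>
          rw [Function.iterate_succ_apply', ih]
          simp [rotV, shift, Equiv.sigmaCongr, add_assoc]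
      intro m
      rw [this]
      simp
  refine Nat.dvd_antisymm ?_ ?_
  · exact Function.IsPeriodicPt.minimalPeriod_dvd ((key _).2 (ZMod.natCast_self _))
  · rw [← ZMod.natCast_eq_zero_iff]
    exact (key _).1 (Function.isPeriodicPt_minimalPeriod _ _)

theorem rotationGraph_spec (hk : 1 ≤ k) (g : Gadget (2 * k + 1) n n) :
    (rotationGraph g).IsR (2 * k + 1) ∧ (rotationGraph g).toGraph.Simple ∧
      (rotationGraph g).toGraph.IsRotationRGraph (2 * k + 1) := by
  have hR : (rotationGraph g).IsR (2 * k + 1) :=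
    (wheel_isR hk).subst (by omega) (fun _ => g.isR) (fun _ => rfl) fun _ => g.mult _
  have hL : (rotationGraph g).Layered
      (Sum.elim (fun v => v.elim (n + 2) fun _ => n + 1) fun p => g.height p.2)
      (fun _ => False) (· = .inl none) := by
    have := (wheel_layered (r := 2 * k + 1) (k := k) (n := n) (fun _ => False) (· = none)
      (by simp) (.inl ⟨rfl, fun _ h => h⟩)).subst (K := fun _ => g.graph) (f := fun _ => g.root)
      (hk := fun _ => g.height) (fun _ => g.layered) (fun _ => g.isR.ne _)
      (fun _ => by rw [g.height_src]; rfl) (fun _ => by rw [g.height_tgt]; rfl)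
    convert! this using 1
    · funext a
      rcases a with (a | a) | a <;> rfl
    · funext a
      rcases a with a | a <;> simp
  have hm : ∀ e, (rotationGraph g).mult e = 1 := by
    rintro (e | ⟨i, e⟩)
    · rfl
    · exact g.mult e
  refine ⟨hR, hL.toGraph_simple hR.ne, hL.isRotationRGraph (by omega) hR hm
    (by simp) (rotV k g.V) (rotE k g.E) ?_ ?_ ?_ rfl fun v => rotV_minimalPeriod⟩
  · rintro ((e | ⟨i, d⟩) | ⟨⟨i, d⟩, e⟩) <;> rfl
  · rintro ((e | ⟨i, d⟩) | ⟨⟨i, d⟩, e⟩)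
    · rfl
    · rfl
    · by_cases he : e = g.root
      · subst he
        have h1 := subst_tgt_inr_self (wheel (2 * k + 1) k) (fun _ => g.graph)
          (fun _ => g.root) (i, d)
        have h2 := subst_tgt_inr_self (wheel (2 * k + 1) k) (fun _ => g.graph)
          (fun _ => g.root) (i + 1, d)
        exact h2.trans (congrArg (rotV k g.V) h1).symm
      · have h1 := subst_tgt_inr_of_ne (wheel (2 * k + 1) k) (fun _ => g.graph)
          (fun _ => g.root) (i := (i, d)) he
        have h2 := subst_tgt_inr_of_ne (wheel (2 * k + 1) k) (fun _ => g.graph)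
          (fun _ => g.root) (i := (i + 1, d)) he
        exact h2.trans (congrArg (rotV k g.V) h1).symm
  · rintro ((_ | i) | ⟨⟨i, d⟩, x⟩) <;> rfl

/-- The generalized Berge conjecture reduces to simple rotation `r`-graphs. -/
theorem hasBergeCover_of_rotation (hk : 1 ≤ k)
    (h : ∀ (α β : Type) (G : Graph α β), G.Simple → G.IsRotationRGraph (2 * k + 1) →
      G.HasBergeCover (2 * k + 1))
    (α β : Type) (G : Graph α β) (hG : G.IsRGraph (2 * k + 1)) :
    G.HasBergeCover (2 * k + 1) := by
  classical
  have := hG.finite_vertexSet.fintype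
  have := hG.finite_edgeSet.fintype
  have hrep := ofGraph_represents G
  have hW := (hrep.isR_iff (fun _ => rfl) _).2 hG
  refine (hrep.hasBerge_iff hW.ne _).1 (HasBerge.of_connected hW (fun _ => rfl) ?_)
  intro V E _ _ W hW hm hc
  obtain ⟨n, g, hg⟩ := exists_gadget hk hW hm hc
  obtain ⟨hR, hs, hrot⟩ := rotationGraph_spec hk g
  have hb := ((rotationGraph g).toGraph_represents.hasBerge_iff hR.ne _).2 (h _ _ _ hs hrot)
  -- Any copy of the gadget will do; `0 < k` ensures that there is one.
  exact hg (HasBerge.subst_gadget (by omega) (fun _ => g.isR) hb (0, ⟨0, hk⟩))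

end final

end WGraph

/-! ### The equivalences and the case `r = 1` -/

lemma Graph.HasFulkersonCover.hasBergeCover {α β : Type} {G : Graph α β} {r : ℕ}
    (h : G.HasFulkersonCover r) : G.HasBergeCover r := by
  obtain ⟨M, hM, hc⟩ := h
  refine ⟨fun i => M (Fin.castLE (by omega) i), fun i => hM _, fun e he => ?_⟩
  by_contra! hcon
  -- An edge missed by all but the last matching would lie in at most one of the `2r`, not in two.
  have h1 : {i | e ∈ M i} ⊆ {i | i.val = 2 * r - 1} := by
    intro i hi
    by_contra hi'
    have hi'' : i.val ≠ 2 * r - 1 := hi'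
    exact hcon ⟨i.val, by omega⟩ hi
  have h2 : {i : Fin (2 * r) | i.val = 2 * r - 1}.ncard ≤ 1 :=
    (Set.ncard_le_one_iff (Set.toFinite _)).2 fun ha hb => Fin.ext (Eq.trans ha (Eq.symm hb))
  have h3 := Set.ncard_le_ncard h1 (Set.toFinite _)
  rw [hc e he] at h3
  omega

/-- All `1`-graphs have a Fulkerson cover. -/
lemma Graph.IsRGraph.hasFulkersonCover_one {α β : Type} {G : Graph α β} (hG : G.IsRGraph 1) :
    G.HasFulkersonCover 1 := by
  refine ⟨fun _ => G.edgeSet, fun _ => ⟨subset_rfl, fun v hv => ?_⟩, fun e he => ?_⟩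
  · obtain ⟨e, he⟩ := Set.ncard_eq_one.1 (hG.regular v hv)
    have h1 : ∀ e', G.Inc e' v ↔ e' = e := fun e' => by
      have : e' ∈ G.incidenceSet v ↔ e' ∈ ({e} : Set β) := by rw [he]
      simpa using this
    exact ⟨e, ⟨((h1 e).2 rfl).edge_mem, (h1 e).2 rfl⟩, fun e' he' => (h1 e').1 he'.2⟩
  · simp [he]

theorem mainTheorem3 (r : ℕ) (hr : Odd r) :
    List.TFAE [
      ∀ (α β : Type) (G : Graph α β), G.IsRGraph r → G.HasFulkersonCover r,
      ∀ (α β : Type) (G : Graph α β), G.Simple → G.IsRotationRGraph r → G.HasFulkersonCover r,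
      ∀ (α β : Type) (G : Graph α β), G.IsRGraph r → G.HasBergeCover r,
      ∀ (α β : Type) (G : Graph α β), G.Simple → G.IsRotationRGraph r → G.HasBergeCover r] := by
  obtain ⟨k, rfl⟩ := hr
  tfae_have 1 → 2 := fun h α β G _ hG => h α β G hG.1
  tfae_have 2 → 4 := fun h α β G hs hG => (h α β G hs hG).hasBergeCover
  tfae_have 4 → 3 := by
    intro h α β G hG
    -- The wheel construction needs `k ≥ 1`, that is `r ≥ 3`.
    rcases Nat.eq_zero_or_pos k with rfl | hk
    · exact Graph.HasFulkersonCover.hasBergeCover (Graph.IsRGraph.hasFulkersonCover_one hG)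
    · exact WGraph.hasBergeCover_of_rotation hk h α β G hG
  tfae_have 3 → 1 := by
    intro h α β G hG
    rcases Nat.eq_zero_or_pos k with rfl | hk
    · exact Graph.IsRGraph.hasFulkersonCover_one hG
    · exact WGraph.hasFulkersonCover_of_berge (by omega) h α β G hG
  tfae_finish
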